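/- **Setting.** Let $k$ be a field and let $(\Gamma,\Lambda)$ be a finite quiver (multiple arrows allowed) without oriented cycles whose underlying graph $\Gamma$ is connected and has more than one vertex; $\Gamma_0$ is its set of vertices. A module $M$ over the path algebra $k(\Gamma,\Lambda)$ means a finite-dimensional one, identified with a representation of the quiver: finite-dimensional $k$-spaces $V(x)$, $x\in\Gamma_0$, and linear maps $V(x)\to V(y)$ for each arrow $x\to y$. A vertex is a *sink* if no arrow starts at it, and $\sigma_x\Lambda$ is obtained from $\Lambda$ by reversing all arrows incident with $x$. For a sink $x$, the positive reflection functor $F_x^+$ takes the representation $(V(z))_z$ to the representation of $(\Gamma,\sigma_x\Lambda)$ which has $\operatorname{Ker}\bigl(\bigoplus_{a:y\to x}V(y)\to V(x)\bigr)$ at $x$ and $V(z)$ at each $z\ne x$; its maps on the reversed arrows $x\to y$ are the component projections of the kernel, and its other maps are unchanged. A finite (possibly empty) sequence $S=x_1,\dots,x_s$ of vertices is *(+)-admissible* if each $x_i$ is a sink for $\sigma_{x_{i-1}}\cdots\sigma_{x_1}\Lambda$. Put $\Lambda^S=\sigma_{x_s}\cdots\sigma_{x_1}\Lambda$ and $F(S)=F_{x_s}^+\cdots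 F_{x_1}^+$. Let $\mathfrak S$ be the set of (+)-admissible sequences on $(\Gamma,\Lambda)$. Then $S\in\mathfrak S$ *annihilates* $M$ if $F(S)M=0$, and $M$ is *preprojective* if some $S\in\mathfrak S$ annihilates it. Let $\sim$ be the equivalence relation on $\mathfrak S$ generated by exchanging two adjacent members of a sequence that are not joined by an edge of $\Gamma$. Write $S\preceq T$ if $T\sim SU$ for some sequence $U$ that is (+)-admissible on $(\Gamma,\Lambda^S)$. A sequence $S\in\mathfrak S$ is a *shortest* sequence annihilating $M$ if $S$ annihilates $M$ and no $T\in\mathfrak S$ with $T\preceq S$, $T\not\sim S$ annihilates $M$. A *canonical form* of $S\in\mathfrak S$ is a concatenation $S_1S_2\cdots S_r\sim S$ in which each segment $S_i$ is nonempty, has distinct members, and has the same set of members as $S_iS_{i+1}\cdots S_r$ ($r=0$ if $S=\emptyset$). The join $S\vee T$, defined up to $\sim$, is the sequence in $\mathfrak S$ whose canonical form has as many segments as the longer of the canonical forms of $S$ and $T$, and whose $i$-th segment has as set of members the union of those of the $i$-th segments of $S$ and of $T$ (a missing segment counting as empty). An empty join is the empty sequence. **Theorem.** Let $M$ be a preprojective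 $k(\Gamma,\Lambda)$-module. (a) There exists a shortest sequence $S_M\in\mathfrak S$ annihilating $M$, and it is unique up to $\sim$. If $M\cong M_1^{m_1}\oplus\cdots\oplus M_t^{m_t}$ where the $M_i$ are pairwise nonisomorphic indecomposable modules and all $m_i>0$, then each $M_i$ is preprojective and $S_M\sim S_{M_1}\vee\cdots\vee S_{M_t}$. (b) If $L$ is a preprojective $k(\Gamma,\Lambda)$-module, then $S_L\preceq S_M$ if and only if for each indecomposable direct summand $X$ of $L$ there is an indecomposable direct summand $Y$ of $M$ with $S_X\preceq S_Y$. -/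

import Mathlib

universe u v w

/-- A quiver with vertex set `V` and arrow set `E` (multiple arrows allowed): an orientation
`src, tgt` of the graph whose edges are the elements of `E`. -/
@[ext]
structure FinQuiver (V : Type u) (E : Type v) where
  src : E → V
  tgt : E → V

namespace FinQuiver

variable {V : Type u} {E : Type v}

/-- The arrows `a : x → y`. -/
def Arrow (Q : FinQuiver V E) (x y : V) : Type v := {a : E // Q.src a = x ∧ Q.tgt a = y}

instance [DecidableEq V] [Fintype E] (Q : FinQuiver V E) (x y : V) : Fintype (Q.Arrow x y) :=
  inferInstanceAs (Fintype {a : E // Q.src a = x ∧ Q.tgt a = y})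

/-- An edge of the underlying graph connects `x` and `y`. -/
def Joined (Q : FinQuiver V E) (x y : V) : Prop :=
  ∃ a : E, (Q.src a = x ∧ Q.tgt a = y) ∨ (Q.src a = y ∧ Q.tgt a = x)

/-- The underlying graph is connected. -/
def Connected (Q : FinQuiver V E) : Prop :=
  Nonempty V ∧ ∀ x y : V, Relation.ReflTransGen Q.Joined x y

/-- There are no oriented cycles: no path of positive length from a vertex to itself. -/
def Acyclic (Q : FinQuiver V E) : Prop :=
  ∀ x : V, ¬ Relation.TransGen (fun y z => ∃ a : E, Q.src a = y ∧ Q.tgt a = z) x x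

/-- A sink: no arrow starts at `x`. -/
def IsSink (Q : FinQuiver V E) (x : V) : Prop := ∀ a : E, Q.src a ≠ x

/-- `σ_x`: reverse each arrow incident with `x`, keep the remaining ones. -/
def reflect [DecidableEq V] (Q : FinQuiver V E) (x : V) : FinQuiver V E where
  src a := if Q.src a = x ∨ Q.tgt a = x then Q.tgt a else Q.src a
  tgt a := if Q.src a = x ∨ Q.tgt a = x then Q.src a else Q.tgt a

section Reflect

variable [DecidableEq V] {Q : FinQuiver V E} {x : V}

theorem reflect_tgt_ne (hx : Q.IsSink x) (a : E) : (Q.reflect x).tgt a ≠ x := by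
  have := hx a
  unfold reflect
  dsimp only
  split_ifs with h
  · exact this
  · tauto

/-- After reflecting at the sink `x`, the arrows `x → z` are the reversed arrows `z → x`. -/
def Arrow.unreverse {z : V} (hx : Q.IsSink x) (a : (Q.reflect x).Arrow x z) : Q.Arrow z x :=
  ⟨a.1, by
    obtain ⟨a, h1, h2⟩ := a
    have := hx a
    simp only [reflect] at h1 h2
    split_ifs at h1 h2 with h
    · exact ⟨h2, h1⟩
    · tauto⟩

/-- After reflecting at `x`, the arrows between vertices other than `x` are the original ones. -/
def Arrow.unreflect {y z : V} (hy : y ≠ x) (hz : z ≠ x) (a : (Q.reflect x).Arrow y z) :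
    Q.Arrow y z :=
  ⟨a.1, by
    obtain ⟨a, h1, h2⟩ := a
    simp only [reflect] at h1 h2
    split_ifs at h1 h2 with h
    · subst h1 h2
      tauto
    · exact ⟨h1, h2⟩⟩

end Reflect

/-! ### Admissible sequences -/

section Sequences

variable [DecidableEq V]

/-- `Λ^S`: reflect successively at the members of `S`, the first member first. -/
def reflectSeq (Q : FinQuiver V E) : List V → FinQuiver V E
  | [] => Q
  | x :: S => (Q.reflect x).reflectSeq S

/-- (+)-admissible sequences of vertices. -/
def Admissible (Q : FinQuiver V E) : List V → Prop
  | [] => True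
  | x :: S => Q.IsSink x ∧ (Q.reflect x).Admissible S

/-- `S` and `T` are admissible and differ by exchanging two adjacent members that no edge
connects. -/
def Swap (Q : FinQuiver V E) (S T : List V) : Prop :=
  Q.Admissible S ∧ Q.Admissible T ∧ ∃ (A B : List V) (x y : V),
    ¬ Q.Joined x y ∧ S = A ++ x :: y :: B ∧ T = A ++ y :: x :: B

/-- `S ∼ T`: the reflexive transitive closure of the (symmetric) relation `Swap`. -/
def SeqEquiv (Q : FinQuiver V E) : List V → List V → Prop := Relation.ReflTransGen Q.Swap

/-- `S ≼ T`: `T ∼ SU` for some `U` which is (+)-admissible for `Λ^S`. -/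
def SeqLE (Q : FinQuiver V E) (S T : List V) : Prop :=
  ∃ U : List V, (Q.reflectSeq S).Admissible U ∧ Q.SeqEquiv T (S ++ U)

/-- `L = [S_1, …, S_r]` is a canonical form of the admissible sequence `S`: `S ∼ S_1 ⋯ S_r`, each
`S_i` is nonempty and has distinct members, and `Supp S_i = Supp (S_i S_{i+1} ⋯ S_r)`.
The canonical form of the empty sequence has `r = 0`. -/
def IsCanonicalForm (Q : FinQuiver V E) (S : List V) (L : List (List V)) : Prop :=
  Q.Admissible S ∧ Q.SeqEquiv S L.flatten ∧
    ∀ (i : ℕ) (hi : i < L.length), L[i] ≠ [] ∧ L[i].Nodup ∧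
      ∀ v : V, v ∈ L[i] ↔ v ∈ (L.drop i).flatten

/-- `R` represents `S ∨ T`: the `i`-th segment of the canonical form of `R` has as support the
union of the supports of the `i`-th segments of `S` and `T`, where a sequence with fewer than `i`
segments contributes nothing. -/
def IsJoin (Q : FinQuiver V E) (S T R : List V) : Prop :=
  ∃ LS LT LR : List (List V),
    Q.IsCanonicalForm S LS ∧ Q.IsCanonicalForm T LT ∧ Q.IsCanonicalForm R LR ∧
      LR.length = max LS.length LT.length ∧
      ∀ (i : ℕ) (v : V), v ∈ LR.getD i [] ↔ v ∈ LS.getD i [] ∨ v ∈ LT.getD i []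

/-- `R` represents the iterated join `S_1 ∨ (S_2 ∨ ⋯ (S_t ∨ ∅))` of a list of sequences; the
empty join is the empty sequence. -/
def IsListJoin (Q : FinQuiver V E) : List (List V) → List V → Prop
  | [], R => R = []
  | S :: L, R => ∃ T : List V, Q.IsListJoin L T ∧ Q.IsJoin S T R

end Sequences

/-! ### Representations -/

/-- Finite-dimensional representations of the quiver `Q` over `k`: a finite-dimensional space for
each vertex and a linear map `V(x) → V(y)` for each arrow `a : x → y`. -/
structure Rep (k : Type w) [Field k] (Q : FinQuiver V E) where
  obj : V → Type (max u v w)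
  [addCommGroup : ∀ x, AddCommGroup (obj x)]
  [module : ∀ x, Module k (obj x)]
  [finiteDimensional : ∀ x, FiniteDimensional k (obj x)]
  map : ∀ {x y : V}, Q.Arrow x y → (obj x →ₗ[k] obj y)

namespace Rep

variable {k : Type w} [Field k] {Q : FinQuiver V E}

attribute [instance] Rep.addCommGroup Rep.module Rep.finiteDimensional

/-- `M = 0`. -/
def IsZero (M : Rep k Q) : Prop := ∀ x, Subsingleton (M.obj x)

/-- `M ≅ N`. -/
def Isomorphic (M N : Rep k Q) : Prop :=
  ∃ φ : ∀ x, M.obj x ≃ₗ[k] N.obj x,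
    ∀ (x y : V) (a : Q.Arrow x y) (m : M.obj x), φ y (M.map a m) = N.map a (φ x m)

/-- The direct sum `M ⊕ N`. -/
def prod (M N : Rep k Q) : Rep k Q where
  obj x := M.obj x × N.obj x
  map a := (M.map a).prodMap (N.map a)

/-- The direct sum of a finite family `N_0, …, N_{t-1}`. -/
def directSum {t : ℕ} (N : Fin t → Rep k Q) : Rep k Q where
  obj x := ∀ i, (N i).obj x
  map a := LinearMap.pi fun i => (N i).map a ∘ₗ LinearMap.proj i

/-- The direct sum `M^m` of `m` copies of `M`. -/
def power (M : Rep k Q) (m : ℕ) : Rep k Q := directSum fun _ : Fin m => M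

/-- Indecomposable: nonzero, and not a direct sum of two nonzero representations. -/
def Indecomposable (M : Rep k Q) : Prop :=
  ¬ M.IsZero ∧ ∀ A B : Rep k Q, M.Isomorphic (A.prod B) → A.IsZero ∨ B.IsZero

/-- `X` is (isomorphic to) a direct summand of `M`. -/
def IsSummand (X M : Rep k Q) : Prop := ∃ C : Rep k Q, M.Isomorphic (X.prod C)

section Reflection

variable [Fintype V] [DecidableEq V] [Fintype E]

/-- The map `h : ⨁ V(y) → V(x)`, the sum over all arrows `a : y → x` ending at `x`. -/
def incoming (M : Rep k Q) (x : V) : (∀ y : V, Q.Arrow y x → M.obj y) →ₗ[k] M.obj x :=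
  ∑ y : V, ∑ a : Q.Arrow y x, M.map a ∘ₗ LinearMap.proj a ∘ₗ LinearMap.proj y

/-- The spaces of `F_x^+ M`: `Ker h` at the vertex `x`, and `V(z)` at `z ≠ x`. The last argument
decides which of the two cases holds. -/
def PlusObj (M : Rep k Q) (x z : V) : Decidable (z = x) → Type (max u v w)
  | isTrue _ => LinearMap.ker (M.incoming x)
  | isFalse _ => M.obj z

instance (M : Rep k Q) (x z : V) : ∀ d : Decidable (z = x), AddCommGroup (M.PlusObj x z d)
  | isTrue _ => inferInstanceAs (AddCommGroup (LinearMap.ker (M.incoming x)))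
  | isFalse _ => inferInstanceAs (AddCommGroup (M.obj z))

instance (M : Rep k Q) (x z : V) : ∀ d : Decidable (z = x), Module k (M.PlusObj x z d)
  | isTrue _ => inferInstanceAs (Module k (LinearMap.ker (M.incoming x)))
  | isFalse _ => inferInstanceAs (Module k (M.obj z))

instance (M : Rep k Q) (x z : V) :
    ∀ d : Decidable (z = x), FiniteDimensional k (M.PlusObj x z d)
  | isTrue _ => inferInstanceAs (FiniteDimensional k (LinearMap.ker (M.incoming x)))
  | isFalse _ => inferInstanceAs (FiniteDimensional k (M.obj z))

/-- The maps of `F_x^+ M`: for an arrow `x → z`, the component of the inclusion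
`Ker h → ⨁ V(y)` at the arrow that was reversed; the maps of `M` on the remaining arrows. No arrow
of the reflected quiver ends at `x`. -/
def plusMap (M : Rep k Q) {x : V} (hx : Q.IsSink x) {y z : V} (a : (Q.reflect x).Arrow y z) :
    ∀ (d : Decidable (y = x)) (d' : Decidable (z = x)), M.PlusObj x y d →ₗ[k] M.PlusObj x z d'
  | _, isTrue hz => absurd (a.2.2.trans hz) (reflect_tgt_ne hx a.1)
  | isTrue hy, isFalse _ =>
      (LinearMap.proj (R := k) (φ := fun _ : Q.Arrow z x => M.obj z)
        (Arrow.unreverse hx ⟨a.1, a.2.1.trans hy, a.2.2⟩)) ∘ₗ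
      (LinearMap.proj (R := k) (φ := fun y' : V => Q.Arrow y' x → M.obj y') z) ∘ₗ
      (LinearMap.ker (M.incoming x)).subtype
  | isFalse hy, isFalse hz => M.map (Arrow.unreflect hy hz a)

/-- The positive reflection functor `F_x^+` at a sink `x`, on objects. -/
def plus (M : Rep k Q) (x : V) (hx : Q.IsSink x) : Rep k (Q.reflect x) where
  obj z := M.PlusObj x z (decEq z x)
  map {y z} a := M.plusMap hx a (decEq y x) (decEq z x)

end Reflection

end Rep

namespace Rep

variable {k : Type w} [Field k] [Fintype V] [DecidableEq V] [Fintype E]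

/-- `F(S)M = F_{x_s}^+ ⋯ F_{x_1}^+ M` for an admissible sequence `S = x_1, …, x_s`. -/
def plusSeq : ∀ (S : List V) {Q : FinQuiver V E} (_ : Rep k Q) (_ : Q.Admissible S),
    Rep k (Q.reflectSeq S)
  | [], _, M, _ => M
  | x :: S, _, M, h => plusSeq S (M.plus x h.1) h.2

variable {Q : FinQuiver V E}

/-- `S` is a (+)-admissible sequence with `F(S)M = 0`. -/
def Annihilates (S : List V) (M : Rep k Q) : Prop :=
  ∃ h : Q.Admissible S, (plusSeq S M h).IsZero

/-- Some (+)-admissible sequence annihilates `M`. -/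
def Preprojective (M : Rep k Q) : Prop := ∃ S : List V, Annihilates S M

/-- `S` annihilates `M`, and no proper subsequence of `S` (that is, no `T ≼ S` with `T ≁ S`)
annihilates `M`. -/
def IsShortest (S : List V) (M : Rep k Q) : Prop :=
  Annihilates S M ∧ ∀ T : List V, Q.SeqLE T S → Annihilates T M → Q.SeqEquiv T S

end Rep

end FinQuiver

/-! An admissible sequence is determined up to `∼` by the multiplicities of its members, and the
vectors `m` that occur are exactly those with `m (src a) ≤ m (tgt a) ≤ m (src a) + 1` for each arrow
(`admissibleVec_count`, `AdmissibleVec.exists_admissible`, `seqEquiv_of_count_eq`). Under this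
dictionary `≼` is the pointwise order (`seqLE_iff`), the join is the pointwise maximum
(`isJoin_of_count`), and pointwise minima exist as well.

Reflections at distinct unjoined sinks commute up to isomorphism, so `F(S)M` depends only on the
class of `S`. Moreover, its space at `z` depends only on the multiplicity of `z` in `S`
(`nonempty_plusSeq_equiv`). Hence the sequences annihilating `M` are closed under minima, and a
shortest one is the same as a pointwise least one (`isShortest_iff`). Since `F(S)` commutes with
direct sums, the least sequence for a sum is the least upper bound of those for the summands, which
is their join.

For (b), each multiplicity in `S_M` is attained by an indecomposable summand
(`IsShortest.exists_summand`), which gives one direction. The other needs `S_X` to be join-prime for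
indecomposable `X`: there is a vertex `x` such that comparing multiplicities at `x` already decides
`S_X ≼ T` (`Indecomposable.exists_joinPrime`). Otherwise `S_X` could end in two distinct unjoined
vertices; dropping both leaves a representation supported at exactly these two, which has an
idempotent other than 0 and 1. But idempotents lift along reflections (`Reflection.exists_lift`),
and `X` has only trivial ones. -/

namespace FinQuiver

/-! ### Admissible sequences and their multiplicity vectors -/

section Combinatorics

variable {V : Type u} {E : Type v} {Q : FinQuiver V E}

/-- The multiplicity vectors of the admissible sequences. -/
def AdmissibleVec (Q : FinQuiver V E) (m : V → ℕ) : Prop :=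
  ∀ a : E, m (Q.src a) ≤ m (Q.tgt a) ∧ m (Q.tgt a) ≤ m (Q.src a) + 1

theorem AdmissibleVec.min {m n : V → ℕ} (hm : Q.AdmissibleVec m) (hn : Q.AdmissibleVec n) :
    Q.AdmissibleVec fun v => min (m v) (n v) := by
  intro a
  have := hm a
  have := hn a
  dsimp only
  omega

theorem AdmissibleVec.max {m n : V → ℕ} (hm : Q.AdmissibleVec m) (hn : Q.AdmissibleVec n) :
    Q.AdmissibleVec fun v => max (m v) (n v) := by
  intro a
  have := hm a
  have := hn a
  dsimp only
  omega

theorem admissibleVec_const (n : ℕ) : Q.AdmissibleVec fun _ => n := fun _ => by simp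

variable [DecidableEq V]

theorem reflect_comm (Q : FinQuiver V E) (x y : V) :
    (Q.reflect x).reflect y = (Q.reflect y).reflect x := by
  ext a
  · simp only [reflect]; split_ifs <;> tauto
  · simp only [reflect]; split_ifs <;> tauto

theorem reflect_src_of_tgt_eq {x : V} {a : E} (h : Q.tgt a = x) :
    (Q.reflect x).src a = x ∧ (Q.reflect x).tgt a = Q.src a := by
  simp [reflect, h]

theorem reflect_of_tgt_ne {x : V} (hx : Q.IsSink x) {a : E} (h : Q.tgt a ≠ x) :
    (Q.reflect x).src a = Q.src a ∧ (Q.reflect x).tgt a = Q.tgt a := by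
  simp [reflect, h, hx a]

theorem joined_reflect (x y z : V) : (Q.reflect x).Joined y z ↔ Q.Joined y z := by
  unfold Joined
  refine exists_congr fun a => ?_
  simp only [reflect]
  split_ifs <;> tauto

theorem joined_reflectSeq (S : List V) (y z : V) : ∀ Q : FinQuiver V E,
    (Q.reflectSeq S).Joined y z ↔ Q.Joined y z := by
  induction S with
  | nil => exact fun _ => Iff.rfl
  | cons x S ih => exact fun Q => (ih _).trans (joined_reflect x y z)

/-- After the reflection no arrow ends at `x`, so a cycle would avoid `x` and use only unchanged
arrows. -/
theorem Acyclic.reflect (hQ : Q.Acyclic) {x : V} (hx : Q.IsSink x) : (Q.reflect x).Acyclic := by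
  have step : ∀ (a : E), (Q.reflect x).src a ≠ x →
      Q.src a = (Q.reflect x).src a ∧ Q.tgt a = (Q.reflect x).tgt a := by
    intro a ha
    by_cases h : Q.tgt a = x
    · exact absurd (reflect_src_of_tgt_eq h).1 ha
    · exact ⟨(reflect_of_tgt_ne hx h).1.symm, (reflect_of_tgt_ne hx h).2.symm⟩
  have key : ∀ y z : V, y ≠ x →
      Relation.TransGen (fun y z => ∃ a : E, (Q.reflect x).src a = y ∧ (Q.reflect x).tgt a = z) y z →
      z ≠ x ∧ Relation.TransGen (fun y z => ∃ a : E, Q.src a = y ∧ Q.tgt a = z) y z := by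
    intro y z hy h
    induction h with
    | single h =>
      obtain ⟨a, rfl, rfl⟩ := h
      exact ⟨reflect_tgt_ne hx a, .single ⟨a, step a hy⟩⟩
    | tail _ h ih =>
      obtain ⟨a, rfl, rfl⟩ := h
      exact ⟨reflect_tgt_ne hx a, ih.2.tail ⟨a, step a ih.1⟩⟩
  intro y hy
  by_cases hyx : y = x
  · subst hyx
    obtain ⟨b, -, a, -, ha⟩ := Relation.TransGen.tail'_iff.1 hy
    exact reflect_tgt_ne hx a ha
  · exact hQ y (key y y hyx hy).2

theorem Acyclic.reflectSeq {S : List V} : ∀ {Q : FinQuiver V E}, Q.Acyclic → Q.Admissible S →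
    (Q.reflectSeq S).Acyclic := by
  induction S with
  | nil => exact fun h _ => h
  | cons x S ih => exact fun h hS => ih (h.reflect hS.1) hS.2

theorem admissible_append {S T : List V} : ∀ {Q : FinQuiver V E},
    Q.Admissible (S ++ T) ↔ Q.Admissible S ∧ (Q.reflectSeq S).Admissible T := by
  induction S with
  | nil => intro Q; simp [Admissible, FinQuiver.reflectSeq]
  | cons x S ih => intro Q; simp [Admissible, FinQuiver.reflectSeq, ih, and_assoc]

/-- Along each arrow the reflections at its two ends alternate, the target coming first. -/
theorem admissibleVec_count {S : List V} : ∀ {Q : FinQuiver V E}, Q.Admissible S →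
    Q.AdmissibleVec fun v => S.count v := by
  induction S with
  | nil => intro Q _ a; simp
  | cons x S ih =>
    intro Q hS a
    have h := ih hS.2 a
    have hsrc := hS.1 a
    dsimp only at h ⊢
    by_cases ht : Q.tgt a = x
    · rw [(reflect_src_of_tgt_eq ht).1, (reflect_src_of_tgt_eq ht).2] at h
      rw [ht, List.count_cons_self, List.count_cons_of_ne hsrc.symm]
      omega
    · rw [(reflect_of_tgt_ne hS.1 ht).1, (reflect_of_tgt_ne hS.1 ht).2] at h
      rwa [List.count_cons_of_ne hsrc.symm, List.count_cons_of_ne (Ne.symm ht)]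

theorem AdmissibleVec.reflect {m m' : V → ℕ} (hm : Q.AdmissibleVec m) {x : V} (hx : Q.IsSink x)
    (h : m x = m' x + 1) (h' : ∀ v, v ≠ x → m' v = m v) : (Q.reflect x).AdmissibleVec m' := by
  intro a
  have hsrc := hx a
  have := hm a
  by_cases ht : Q.tgt a = x
  · rw [(reflect_src_of_tgt_eq ht).1, (reflect_src_of_tgt_eq ht).2, h' _ hsrc]
    rw [ht] at this
    omega
  · rw [(reflect_of_tgt_ne hx ht).1, (reflect_of_tgt_ne hx ht).2, h' _ hsrc, h' _ ht]
    exact this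

theorem AdmissibleVec.reflectSeq {S : List V} : ∀ {Q : FinQuiver V E} {m m' : V → ℕ},
    Q.AdmissibleVec m → Q.Admissible S → (∀ v, m v = S.count v + m' v) →
    (Q.reflectSeq S).AdmissibleVec m' := by
  induction S with
  | nil =>
    intro Q m m' hm _ h
    have : m = m' := by ext v; simpa using h v
    exact this ▸ hm
  | cons x S ih =>
    intro Q m m' hm hS h
    refine ih (m := fun v => S.count v + m' v) (hm.reflect hS.1 ?_ fun v hv => ?_) hS.2
      fun _ => rfl
    · rw [h, List.count_cons_self]; ring
    · rw [h, List.count_cons_of_ne hv.symm]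

/-- A nonzero admissible vector does not vanish at some sink. -/
theorem AdmissibleVec.exists_sink [Finite V] (hQ : Q.Acyclic) {m : V → ℕ}
    (hm : Q.AdmissibleVec m) {v : V} (hv : 0 < m v) : ∃ x, Q.IsSink x ∧ 0 < m x := by
  -- Reachable vertices count as smaller, so the induction walks along arrows until it meets a sink;
  -- `m` does not decrease on the way.
  let r : V → V → Prop :=
    fun z y => Relation.TransGen (fun y z => ∃ a : E, Q.src a = y ∧ Q.tgt a = z) y z
  have : IsTrans V r := ⟨fun _ _ _ h h' => h'.trans h⟩
  have : Std.Irrefl r := ⟨hQ⟩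
  have hwf : WellFounded r := Finite.wellFounded_of_trans_of_irrefl r
  induction v using hwf.induction with
  | _ v ih =>
    by_cases hs : Q.IsSink v
    · exact ⟨v, hs, hv⟩
    · obtain ⟨a, ha⟩ : ∃ a, Q.src a = v := by simpa [IsSink] using hs
      refine ih (Q.tgt a) (.single ⟨a, ha, rfl⟩) (lt_of_lt_of_le hv ?_)
      rw [← ha]
      exact (hm a).1

/-- A sink with positive multiplicity can serve as the first member. Lowering its multiplicity by
one gives an admissible vector for the reflected quiver with a smaller total. -/
theorem AdmissibleVec.exists_admissible [Fintype V] : ∀ {Q : FinQuiver V E}, Q.Acyclic →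
    ∀ {m : V → ℕ}, Q.AdmissibleVec m → ∃ S, Q.Admissible S ∧ ∀ v, S.count v = m v := by
  have key : ∀ (n : ℕ) {Q : FinQuiver V E}, Q.Acyclic → ∀ {m : V → ℕ}, Q.AdmissibleVec m →
      ∑ v, m v = n → ∃ S, Q.Admissible S ∧ ∀ v, S.count v = m v := by
    intro n
    induction n with
    | zero =>
      intro Q _ m _ h
      refine ⟨[], trivial, fun v => ?_⟩
      simpa using (Finset.sum_eq_zero_iff.1 h v (Finset.mem_univ v)).symm
    | succ n ih =>
      intro Q hQ m hm h
      obtain ⟨v, hv⟩ : ∃ v, 0 < m v := by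
        by_contra! h0
        have : ∑ v, m v = 0 := Finset.sum_eq_zero fun v _ => Nat.le_zero.1 (h0 v)
        omega
      obtain ⟨x, hx, hmx⟩ := hm.exists_sink hQ hv
      have hup : m = Function.update m x (m x - 1) + Pi.single x 1 := by
        ext z
        rcases eq_or_ne z x with rfl | hz
        · simp; omega
        · simp [hz]
      have hsum : ∑ v, Function.update m x (m x - 1) v = n := by
        have h2 : ∑ v, m v = ∑ v, Function.update m x (m x - 1) v + 1 := by
          conv_lhs => rw [hup]
          simp only [Pi.add_apply, Finset.sum_add_distrib]
          simp
        omega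
      obtain ⟨S, hS, hc⟩ := ih (hQ.reflect hx) (hm.reflect hx (m' := Function.update m x (m x - 1))
        (by simp; omega) fun v hv => by simp [hv]) hsum
      refine ⟨x :: S, ⟨hx, hS⟩, fun v => ?_⟩
      rcases eq_or_ne v x with rfl | hvx
      · rw [List.count_cons_self, hc]; simp; omega
      · rw [List.count_cons_of_ne hvx.symm, hc]; simp [hvx]
  exact fun {_} hQ _ hm => key _ hQ hm rfl

theorem Swap.cons {x : V} (hx : Q.IsSink x) {S T : List V} (h : (Q.reflect x).Swap S T) :
    Q.Swap (x :: S) (x :: T) := by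
  obtain ⟨hS, hT, A, B, y, z, hyz, rfl, rfl⟩ := h
  exact ⟨⟨hx, hS⟩, ⟨hx, hT⟩, x :: A, B, y, z, fun h => hyz ((joined_reflect x y z).2 h), rfl, rfl⟩

theorem SeqEquiv.cons {x : V} (hx : Q.IsSink x) {S T : List V}
    (h : (Q.reflect x).SeqEquiv S T) : Q.SeqEquiv (x :: S) (x :: T) :=
  Relation.ReflTransGen.lift (x :: ·) (fun _ _ h => Swap.cons hx h) _ _ h

theorem SeqEquiv.count_eq {S T : List V} (h : Q.SeqEquiv S T) (v : V) : S.count v = T.count v := by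
  induction h with
  | refl => rfl
  | tail _ h ih =>
    obtain ⟨-, -, A, B, x, y, -, rfl, rfl⟩ := h
    rw [ih]
    exact List.Perm.count_eq (List.Perm.append_left A (List.Perm.swap y x B)) v

theorem SeqEquiv.admissible {S T : List V} (h : Q.SeqEquiv S T) (hS : Q.Admissible S) :
    Q.Admissible T := by
  induction h with
  | refl => exact hS
  | tail _ h _ => exact h.2.1

theorem isSink_of_isSink_reflect {x y : V} (hxy : ¬ Q.Joined x y) (hy : Q.IsSink y)
    (hx : (Q.reflect y).IsSink x) : Q.IsSink x := by
  intro a ha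
  have hne : Q.tgt a ≠ y := fun h => hxy ⟨a, Or.inl ⟨ha, h⟩⟩
  exact hx a ((reflect_of_tgt_ne hy hne).1.trans ha)

theorem isSink_reflect {x y : V} (hxy : x ≠ y) (hx : Q.IsSink x) (hy : Q.IsSink y) :
    (Q.reflect x).IsSink y := by
  intro a ha
  by_cases h : Q.tgt a = x
  · exact hxy ((reflect_src_of_tgt_eq h).1.symm.trans ha)
  · exact hy a ((reflect_of_tgt_ne hx h).1.symm.trans ha)

theorem Admissible.swap {x y : V} {B : List V} (hxy : ¬ Q.Joined x y) (hne : x ≠ y)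
    (h : Q.Admissible (y :: x :: B)) : Q.Admissible (x :: y :: B) := by
  obtain ⟨hy, hx, hB⟩ := h
  have hx' := isSink_of_isSink_reflect hxy hy hx
  exact ⟨hx', isSink_reflect hne hx' hy, reflect_comm Q x y ▸ hB⟩

/-- A sink may be moved to the front across vertices that are not joined to it. -/
theorem SeqEquiv.move_front {x : V} {B A : List V} : ∀ {Q : FinQuiver V E},
    (∀ y ∈ A, y ≠ x ∧ ¬ Q.Joined x y) → Q.Admissible (A ++ x :: B) →
    Q.Admissible (x :: (A ++ B)) ∧ Q.SeqEquiv (x :: (A ++ B)) (A ++ x :: B) := by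
  induction A with
  | nil => exact fun _ h => ⟨h, .refl⟩
  | cons y A ih =>
    intro Q hA h
    obtain ⟨hne, hj⟩ := hA y (by simp)
    obtain ⟨h1, h2⟩ := ih (Q := Q.reflect y) (fun z hz => by
      rw [joined_reflect]; exact hA z (by simp [hz])) h.2
    have h3 : Q.Admissible (y :: x :: (A ++ B)) := ⟨h.1, h1⟩
    have h4 := h3.swap hj hne.symm
    exact ⟨h4, .head ⟨h4, h3, [], A ++ B, x, y, hj, rfl, rfl⟩ (h2.cons h.1)⟩

/-- The first member of `S` can be moved to the front of `T` from its first occurrence there; the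
tails are then compared by induction. -/
theorem seqEquiv_of_count_eq {S : List V} : ∀ {Q : FinQuiver V E} {T : List V},
    Q.Admissible S → Q.Admissible T → (∀ v, S.count v = T.count v) → Q.SeqEquiv S T := by
  induction S with
  | nil =>
    intro Q T _ _ h
    have : T = [] := by
      rw [List.eq_nil_iff_forall_not_mem]
      exact fun v => List.count_eq_zero.1 (h v).symm
    exact this ▸ .refl
  | cons x S ih =>
    intro Q T hS hT h
    have hx : x ∈ T := by
      rw [← List.count_pos_iff, ← h, List.count_cons_self]; omega
    obtain ⟨A, B, rfl, hxA⟩ := List.eq_append_cons_of_mem hx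
    have hA := admissibleVec_count (admissible_append.1 hT).1
    -- A neighbour `y` of the sink `x` is the source of an arrow into `x`, so its multiplicity in
    -- `A` is at most that of `x`, which is 0.
    obtain ⟨h1, h2⟩ := SeqEquiv.move_front (x := x) (A := A) (B := B) (Q := Q) (fun y hy => by
      refine ⟨fun h => hxA (h ▸ hy), ?_⟩
      rintro ⟨a, ⟨ha, -⟩ | ⟨ha, ha'⟩⟩
      · exact hS.1 a ha
      · have := (hA a).1
        simp only [ha, ha', List.count_eq_zero.2 hxA] at this
        exact List.count_eq_zero.1 (Nat.le_zero.1 this) hy) hT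
    refine .trans ((ih hS.2 h1.2 fun v => ?_).cons hS.1) h2
    have := h v
    simp only [List.count_append, List.count_cons] at this ⊢
    omega

/-- For the converse, the difference of the two vectors is admissible for `Λ^S`, and a sequence `U`
realizing it is the missing continuation. -/
theorem seqLE_iff [Fintype V] (hQ : Q.Acyclic) {S T : List V} (hS : Q.Admissible S)
    (hT : Q.Admissible T) : Q.SeqLE S T ↔ ∀ v, S.count v ≤ T.count v := by
  constructor
  · rintro ⟨U, -, h⟩ v
    rw [h.count_eq v, List.count_append]
    omega
  · intro h
    obtain ⟨U, hU, hc⟩ := AdmissibleVec.exists_admissible (hQ.reflectSeq hS)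
      ((admissibleVec_count hT).reflectSeq hS (m' := fun v => T.count v - S.count v)
        fun v => by have := h v; omega)
    refine ⟨U, hU, seqEquiv_of_count_eq hT (admissible_append.2 ⟨hS, hU⟩) fun v => ?_⟩
    have := h v
    rw [List.count_append, hc]
    omega

/-- In `S ∼ TU` the sequence `U` is nonempty; its last member is `y`. -/
theorem exists_concat_of_lt [Fintype V] (hQ : Q.Acyclic) {S T : List V} (hS : Q.Admissible S)
    (hT : Q.Admissible T) (hle : ∀ v, T.count v ≤ S.count v) {v : V}
    (hv : T.count v < S.count v) : ∃ (S' : List V) (y : V), Q.Admissible S' ∧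
      (∀ v, S.count v = (S' ++ [y]).count v) ∧ T.count y < S.count y := by
  obtain ⟨U, hU, hSU⟩ := (seqLE_iff hQ hT hS).2 hle
  have hTU := admissible_append.2 ⟨hT, hU⟩
  obtain rfl | ⟨U', y, rfl⟩ := U.eq_nil_or_concat'
  · have := hSU.count_eq v
    rw [List.append_nil] at this
    omega
  · refine ⟨T ++ U', y, ?_, fun v => ?_, ?_⟩
    · rw [← List.append_assoc] at hTU
      exact (admissible_append.1 hTU).1
    · rw [hSU.count_eq, List.append_assoc]
    · rw [hSU.count_eq, List.count_append, List.count_append, List.count_singleton_self]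
      omega

/-! ### Canonical forms and joins -/

/-- The segments are the superlevel sets of `m`, indexed from 0: split off the admissible vector
`min m 1` as the first segment and continue with `m - 1`. The bound `n` only drives the induction.
-/
theorem exists_segments [Fintype V] (n : ℕ) : ∀ {Q : FinQuiver V E}, Q.Acyclic →
    ∀ {m : V → ℕ}, Q.AdmissibleVec m → (∀ v, m v ≤ n) →
    ∃ L : List (List V), Q.Admissible L.flatten ∧ (∀ v, L.flatten.count v = m v) ∧
      (∀ l ∈ L, l ≠ [] ∧ l.Nodup) ∧ ∀ i v, v ∈ L.getD i [] ↔ i < m v := by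
  have hzero : ∀ (Q : FinQuiver V E) (m : V → ℕ), (∀ v, m v = 0) →
      ∃ L : List (List V), Q.Admissible L.flatten ∧ (∀ v, L.flatten.count v = m v) ∧
      (∀ l ∈ L, l ≠ [] ∧ l.Nodup) ∧ ∀ i v, v ∈ L.getD i [] ↔ i < m v :=
    fun Q m h => ⟨[], trivial, by simp [h], by simp, by simp [h]⟩
  induction n with
  | zero => exact fun _ _ _ h => hzero _ _ fun v => Nat.le_zero.1 (h v)
  | succ n ih =>
    intro Q hQ m hm hn
    by_cases h0 : ∀ v, m v = 0
    · exact hzero _ _ h0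
    obtain ⟨w, hw⟩ := not_forall.1 h0
    obtain ⟨S, hS, hc⟩ := (hm.min (admissibleVec_const 1)).exists_admissible hQ
    obtain ⟨L, hL, hLc, hLn, hLm⟩ := ih (hQ.reflectSeq hS)
      (hm.reflectSeq hS (m' := fun v => m v - 1) fun v => by rw [hc]; omega)
      fun v => by have := hn v; omega
    have hmem : ∀ v, v ∈ S ↔ 0 < m v := fun v => by rw [← List.count_pos_iff, hc]; omega
    refine ⟨S :: L, admissible_append.2 ⟨hS, hL⟩, fun v => ?_, ?_, ?_⟩
    · rw [List.flatten_cons, List.count_append, hc, hLc]; omega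
    · rintro l (_ | ⟨_, hl⟩)
      · refine ⟨List.ne_nil_of_mem ((hmem w).2 (Nat.pos_of_ne_zero hw)), ?_⟩
        rw [List.nodup_iff_count_le_one]
        exact fun v => by rw [hc]; omega
      · exact hLn l hl
    · rintro (_ | i) v
      · simpa using hmem v
      · rw [List.getD_cons_succ, hLm]; omega

theorem exists_isCanonicalForm [Fintype V] (hQ : Q.Acyclic) {S : List V} (hS : Q.Admissible S) :
    ∃ L, Q.IsCanonicalForm S L ∧ (∀ i v, v ∈ L.getD i [] ↔ i < S.count v) ∧
      ∀ i, i < L.length ↔ ∃ v, i < S.count v := by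
  obtain ⟨L, hL, hLc, hLn, hLm⟩ := exists_segments S.length hQ (admissibleVec_count hS)
    fun v => List.count_le_length
  have hget : ∀ (i : ℕ) (hi : i < L.length) (v : V), v ∈ L[i] ↔ i < S.count v := by
    intro i hi v
    rw [← hLm, List.getD_eq_getElem _ _ hi]
  refine ⟨L, ⟨hS, seqEquiv_of_count_eq hS hL fun v => (hLc v).symm, fun i hi => ?_⟩, hLm,
    fun i => ⟨fun hi => ?_, ?_⟩⟩
  · obtain ⟨h1, h2⟩ := hLn L[i] (List.getElem_mem hi)
    refine ⟨h1, h2, fun v => ⟨fun hv => ?_, fun hv => ?_⟩⟩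
    · refine List.mem_flatten.2 ⟨L[i], ?_, hv⟩
      rw [List.drop_eq_getElem_cons hi]
      exact List.mem_cons_self
    · obtain ⟨l, hl, hvl⟩ := List.mem_flatten.1 hv
      obtain ⟨j, hj, rfl⟩ := List.mem_iff_getElem.1 hl
      rw [List.getElem_drop, hget] at hvl
      rw [hget]
      omega
  · obtain ⟨v, hv⟩ := List.exists_mem_of_ne_nil _ (hLn L[i] (List.getElem_mem hi)).1
    exact ⟨v, (hget i hi v).1 hv⟩
  · rintro ⟨v, hv⟩
    by_contra hi
    have := (hLm i v).2 hv
    rw [List.getD_eq_default _ _ (not_lt.1 hi)] at this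
    simp at this

/-- Superlevel sets of a maximum are unions of superlevel sets. -/
theorem isJoin_of_count [Fintype V] (hQ : Q.Acyclic) {S T R : List V} (hS : Q.Admissible S)
    (hT : Q.Admissible T) (hR : Q.Admissible R)
    (h : ∀ v, R.count v = max (S.count v) (T.count v)) : Q.IsJoin S T R := by
  obtain ⟨LS, hLS, hS1, hS2⟩ := exists_isCanonicalForm hQ hS
  obtain ⟨LT, hLT, hT1, hT2⟩ := exists_isCanonicalForm hQ hT
  obtain ⟨LR, hLR, hR1, hR2⟩ := exists_isCanonicalForm hQ hR
  refine ⟨LS, LT, LR, hLS, hLT, hLR, ?_, fun i v => ?_⟩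
  · refine eq_of_forall_lt_iff fun i => ?_
    rw [hR2, lt_max_iff, hS2, hT2, ← exists_or]
    simp only [h, lt_max_iff]
  · rw [hR1, hS1, hT1, h, lt_max_iff]

/-- A least upper bound of a list of admissible sequences is their join. -/
theorem isListJoin_of_isLeast [Fintype V] (hQ : Q.Acyclic) {L : List (List V)} {R : List V}
    (hR : Q.Admissible R) (hL : ∀ S ∈ L, Q.Admissible S)
    (h1 : ∀ S ∈ L, ∀ v, S.count v ≤ R.count v)
    (h2 : ∀ T, Q.Admissible T → (∀ S ∈ L, ∀ v, S.count v ≤ T.count v) →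
      ∀ v, R.count v ≤ T.count v) : Q.IsListJoin L R := by
  induction L generalizing R with
  | nil =>
    refine List.eq_nil_iff_forall_not_mem.2 fun v => List.count_eq_zero.1 ?_
    simpa using h2 [] trivial (by simp) v
  | cons S L ih =>
    have hsup : Q.AdmissibleVec fun v => (L.map fun S => S.count v).foldr max 0 := by
      have hL' : ∀ S ∈ L, Q.Admissible S := fun S hS => hL S (by simp [hS])
      clear ih hL h1 h2
      induction L with
      | nil => exact admissibleVec_const 0
      | cons S L ih =>
        exact (admissibleVec_count (hL' S (by simp))).max (ih fun S hS => hL' S (by simp [hS]))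
    have hle : ∀ (v : V) (n : ℕ), (L.map fun S => S.count v).foldr max 0 ≤ n ↔
        ∀ S ∈ L, S.count v ≤ n := by
      intro v n
      clear ih hL h1 h2 hsup
      induction L with
      | nil => simp
      | cons S L ih => simp [ih]
    obtain ⟨T, hT, hTc⟩ := hsup.exists_admissible hQ
    have hT1 : ∀ S ∈ L, ∀ v, S.count v ≤ T.count v := fun S hS v =>
      (hle v _).1 (hTc v).ge S hS
    have hT2 : ∀ T' : List V, (∀ S ∈ L, ∀ v, S.count v ≤ T'.count v) → ∀ v, T.count v ≤ T'.count v :=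
      fun T' h v => (hTc v).le.trans ((hle v _).2 fun S hS => h S hS v)
    have hS := hL S (by simp)
    refine ⟨T, ih hT (fun S hS => hL S (by simp [hS])) hT1 fun T' _ h => hT2 T' h,
      isJoin_of_count hQ hS hT hR fun v => le_antisymm ?_ ?_⟩
    -- The maximum of `S` and `T` is itself realized by an admissible sequence, so it is an upper
    -- bound to which `h2` applies.
    · obtain ⟨U, hU, hUc⟩ := ((admissibleVec_count hS).max
        (admissibleVec_count hT)).exists_admissible hQ
      rw [← hUc v]
      refine h2 U hU (fun S' hS' v => ?_) v
      rw [hUc]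
      rcases List.mem_cons.1 hS' with rfl | hS'
      · exact le_max_left _ _
      · exact (hT1 S' hS' v).trans (le_max_right _ _)
    · exact max_le (h1 S (by simp) v) (hT2 R (fun S hS => h1 S (by simp [hS])) v)

end Combinatorics

end FinQuiver

/-! ### Reversing the arrows at a set of sinks -/

namespace FinQuiver

/-- `Q'` arises from `Q` by reversing the arrows ending in `X`, all elements of `X` being sinks. -/
structure IsReflected {V : Type u} {E : Type v} (Q Q' : FinQuiver V E) (X : Set V) : Prop where
  tgt_notMem : ∀ a, Q'.tgt a ∉ X
  of_src_notMem : ∀ a, Q'.src a ∉ X → Q.src a = Q'.src a ∧ Q.tgt a = Q'.tgt a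
  of_src_mem : ∀ a, Q'.src a ∈ X → Q.src a = Q'.tgt a ∧ Q.tgt a = Q'.src a

namespace IsReflected

variable {V : Type u} {E : Type v} {Q Q' : FinQuiver V E} {X : Set V}

theorem src_notMem (h : IsReflected Q Q' X) (a : E) : Q.src a ∉ X := by
  by_cases ha : Q'.src a ∈ X
  · rw [(h.of_src_mem a ha).1]; exact h.tgt_notMem a
  · rwa [(h.of_src_notMem a ha).1]

theorem of_tgt_mem (h : IsReflected Q Q' X) {a : E} (ha : Q.tgt a ∈ X) :
    Q'.src a = Q.tgt a ∧ Q'.tgt a = Q.src a := by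
  by_cases ha' : Q'.src a ∈ X
  · exact ⟨(h.of_src_mem a ha').2.symm, (h.of_src_mem a ha').1.symm⟩
  · rw [(h.of_src_notMem a ha').2] at ha
    exact absurd ha (h.tgt_notMem a)

theorem of_tgt_notMem (h : IsReflected Q Q' X) {a : E} (ha : Q.tgt a ∉ X) :
    Q'.src a = Q.src a ∧ Q'.tgt a = Q.tgt a := by
  by_cases ha' : Q'.src a ∈ X
  · rw [(h.of_src_mem a ha').2] at ha
    exact absurd ha' ha
  · exact ⟨(h.of_src_notMem a ha').1.symm, (h.of_src_notMem a ha').2.symm⟩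

end IsReflected

theorem isReflected_reflect {V : Type u} {E : Type v} [DecidableEq V] {Q : FinQuiver V E} {x : V}
    (hx : Q.IsSink x) : IsReflected Q (Q.reflect x) {x} where
  tgt_notMem a := reflect_tgt_ne hx a
  of_src_notMem a ha := by
    by_cases h : Q.tgt a = x
    · exact absurd (reflect_src_of_tgt_eq h).1 ha
    · exact ⟨(reflect_of_tgt_ne hx h).1.symm, (reflect_of_tgt_ne hx h).2.symm⟩
  of_src_mem a ha := by
    by_cases h : Q.tgt a = x
    · exact ⟨(reflect_src_of_tgt_eq h).2.symm, h.trans (reflect_src_of_tgt_eq h).1.symm⟩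
    · exact absurd ((reflect_of_tgt_ne hx h).1.symm.trans ha) (hx a)

/-- Treating the pair as one set gives a description symmetric in `x` and `y`, from which the
commutation of the two functors follows. -/
theorem isReflected_reflect_reflect {V : Type u} {E : Type v} [DecidableEq V]
    {Q : FinQuiver V E} {x y : V} (hx : Q.IsSink x) (hy : (Q.reflect x).IsSink y)
    (hne : x ≠ y) (hxy : ¬ Q.Joined x y) : IsReflected Q ((Q.reflect x).reflect y) ({x} ∪ {y}) := by
  have hy' : Q.IsSink y := isSink_of_isSink_reflect
    (fun ⟨a, h⟩ => hxy ⟨a, h.symm⟩) hx hy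
  have h1 : ∀ a, Q.src a ≠ x := hx
  have h2 : ∀ a, Q.src a ≠ y := hy'
  constructor
  all_goals
    intro a
    have := h1 a
    have := h2 a
    simp only [reflect, Set.mem_union, Set.mem_singleton_iff]
    split_ifs <;> grind

/-! ### Isomorphisms, direct sums and an isomorphism-invariant description of reflections -/

namespace Rep

variable {V : Type u} {E : Type v} {k : Type w} [Field k]

/-- Isomorphism of representations of two equal quivers. -/
def HIso {Q Q' : FinQuiver V E} (M : Rep k Q) (N : Rep k Q') : Prop :=
  Q = Q' ∧ ∃ φ : ∀ x, M.obj x ≃ₗ[k] N.obj x, ∀ (x y : V) (a : Q.Arrow x y) (b : Q'.Arrow x y),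
    a.1 = b.1 → ∀ m, φ y (M.map a m) = N.map b (φ x m)

section HIso

variable {Q Q' Q'' : FinQuiver V E} {M : Rep k Q} {N : Rep k Q'} {P : Rep k Q''}

theorem hiso_iff_isomorphic {N : Rep k Q} : HIso M N ↔ M.Isomorphic N := by
  constructor
  · rintro ⟨-, φ, h⟩
    exact ⟨φ, fun x y a => h x y a a rfl⟩
  · rintro ⟨φ, h⟩
    refine ⟨rfl, φ, fun x y a b hab => ?_⟩
    obtain rfl : a = b := Subtype.ext hab
    exact h x y a

theorem Isomorphic.refl (M : Rep k Q) : M.Isomorphic M :=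
  ⟨fun _ => LinearEquiv.refl k _, fun _ _ _ _ => rfl⟩

theorem HIso.refl (M : Rep k Q) : HIso M M := hiso_iff_isomorphic.2 (.refl M)

theorem Isomorphic.trans {N P : Rep k Q} (h : M.Isomorphic N) (h' : N.Isomorphic P) :
    M.Isomorphic P := by
  obtain ⟨φ, hφ⟩ := h
  obtain ⟨ψ, hψ⟩ := h'
  exact ⟨fun x => (φ x).trans (ψ x), fun x y a m => by simp [hφ, hψ]⟩

theorem HIso.trans (h : HIso M N) (h' : HIso N P) : HIso M P := by
  obtain rfl := h.1
  obtain rfl := h'.1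
  exact hiso_iff_isomorphic.2 ((hiso_iff_isomorphic.1 h).trans (hiso_iff_isomorphic.1 h'))

theorem Isomorphic.symm {N : Rep k Q} (h : M.Isomorphic N) : N.Isomorphic M := by
  obtain ⟨φ, hφ⟩ := h
  refine ⟨fun x => (φ x).symm, fun x y a m => ?_⟩
  rw [LinearEquiv.symm_apply_eq, hφ, LinearEquiv.apply_symm_apply]

theorem HIso.nonempty_equiv (h : HIso M N) (x : V) : Nonempty (M.obj x ≃ₗ[k] N.obj x) :=
  let ⟨φ, _⟩ := h.2
  ⟨φ x⟩

theorem HIso.isZero_iff (h : HIso M N) : M.IsZero ↔ N.IsZero :=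
  forall_congr' fun x => (h.nonempty_equiv x).some.toEquiv.subsingleton_congr

theorem Isomorphic.prod {M' N N' : Rep k Q} (h : M.Isomorphic N) (h' : M'.Isomorphic N') :
    (M.prod M').Isomorphic (N.prod N') := by
  obtain ⟨φ, hφ⟩ := h
  obtain ⟨ψ, hψ⟩ := h'
  exact ⟨fun x => (φ x).prodCongr (ψ x), fun x y a m => Prod.ext (hφ x y a m.1) (hψ x y a m.2)⟩

theorem isZero_prod {N : Rep k Q} : (M.prod N).IsZero ↔ M.IsZero ∧ N.IsZero := by
  refine ⟨fun h => ⟨fun x => ?_, fun x => ?_⟩, fun h x => ?_⟩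
  · have : Subsingleton (M.obj x × N.obj x) := h x
    exact (LinearMap.inl_injective (R := k) (M := M.obj x) (M₂ := N.obj x)).subsingleton
  · have : Subsingleton (M.obj x × N.obj x) := h x
    exact (LinearMap.inr_injective (R := k) (M := M.obj x) (M₂ := N.obj x)).subsingleton
  · have := h.1 x
    have := h.2 x
    exact inferInstanceAs (Subsingleton (M.obj x × N.obj x))

theorem isomorphic_prod_comm (A B : Rep k Q) : (A.prod B).Isomorphic (B.prod A) :=
  ⟨fun x => LinearEquiv.prodComm k (A.obj x) (B.obj x), fun _ _ _ _ => rfl⟩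

theorem isomorphic_prod_assoc (A B C : Rep k Q) :
    ((A.prod B).prod C).Isomorphic (A.prod (B.prod C)) :=
  ⟨fun x => LinearEquiv.prodAssoc k (A.obj x) (B.obj x) (C.obj x), fun _ _ _ _ => rfl⟩

theorem isSummand_self (M : Rep k Q) : M.IsSummand M := by
  let O : Rep k Q := { obj := fun _ => PUnit.{max u v w + 1}, map := fun _ => 0 }
  exact ⟨O, fun x =>
    (LinearEquiv.prodUnique (R := k) (M := M.obj x) (M₂ := PUnit.{max u v w + 1})).symm,
    fun _ _ _ _ => rfl⟩

theorem IsSummand.of_isomorphic_prod {X A B : Rep k Q} (hX : X.IsSummand A)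
    (h : M.Isomorphic (A.prod B)) : X.IsSummand M := by
  obtain ⟨C, hC⟩ := hX
  exact ⟨C.prod B, (h.trans (hC.prod (.refl B))).trans (isomorphic_prod_assoc X C B)⟩

theorem directSum_succ {t : ℕ} (N : Fin (t + 1) → Rep k Q) :
    (directSum N).Isomorphic ((N 0).prod (directSum fun i => N i.succ)) :=
  ⟨fun x => (Fin.consLinearEquiv k fun i => (N i).obj x).symm, fun _ _ _ _ => rfl⟩

theorem finrank_pos_of_not_isZero [Fintype V] (hM : ¬ M.IsZero) :
    0 < ∑ x, Module.finrank k (M.obj x) := by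
  obtain ⟨x, hx⟩ := not_forall.1 hM
  rw [not_subsingleton_iff_nontrivial] at hx
  exact Finset.sum_pos' (fun _ _ => Nat.zero_le _) ⟨x, Finset.mem_univ x, Module.finrank_pos⟩

end HIso

variable [Fintype V] [DecidableEq V] [Fintype E] {Q Q' Q'' : FinQuiver V E} {M : Rep k Q}

theorem incoming_apply (M : Rep k Q) (x : V) (u : ∀ y : V, Q.Arrow y x → M.obj y) :
    M.incoming x u = ∑ y : V, ∑ a : Q.Arrow y x, M.map a (u y a) := by
  simp [incoming]

/-- `N` is obtained from `M` by applying the reflection functors at all the elements of `X`. -/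
structure Reflection (M : Rep k Q) (X : Set V) (N : Rep k Q') where
  isReflected : IsReflected Q Q' X
  away : ∀ z, z ∉ X → (N.obj z ≃ₗ[k] M.obj z)
  emb : ∀ x, x ∈ X → (N.obj x →ₗ[k] ∀ y : V, Q.Arrow y x → M.obj y)
  emb_injective : ∀ x hx, Function.Injective (emb x hx)
  exists_emb_iff : ∀ x hx u, (∃ v, emb x hx v = u) ↔ M.incoming x u = 0
  away_map : ∀ {y z : V} (a : Q'.Arrow y z) (b : Q.Arrow y z), a.1 = b.1 → ∀ hy hz v,
    away z hz (N.map a v) = M.map b (away y hy v)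
  away_map_of_mem : ∀ {x z : V} (a : Q'.Arrow x z) (b : Q.Arrow z x), a.1 = b.1 → ∀ hx hz v,
    away z hz (N.map a v) = emb x hx v z b

namespace Reflection

variable {X : Set V} {N : Rep k Q'}

/-- Outside `X` both spaces are identified with those of `M`; on `X` both embeddings have the same
image, the kernel of `incoming`. The arrow maps are prescribed through these identifications. -/
theorem isomorphic {N' : Rep k Q'} (r : Reflection M X N) (r' : Reflection M X N') :
    N.Isomorphic N' := by
  have hloc : ∀ x, ∃ φ : N.obj x ≃ₗ[k] N'.obj x,
      (∀ (hx : x ∉ X) v, r'.away x hx (φ v) = r.away x hx v) ∧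
      (∀ (hx : x ∈ X) v, r'.emb x hx (φ v) = r.emb x hx v) := by
    intro x
    by_cases hx : x ∈ X
    · have hrange : LinearMap.range (r.emb x hx) = LinearMap.range (r'.emb x hx) := by
        ext u
        rw [LinearMap.mem_range, LinearMap.mem_range, r.exists_emb_iff, r'.exists_emb_iff]
      let φ := (LinearEquiv.ofInjective _ (r.emb_injective x hx)).trans
        ((LinearEquiv.ofEq _ _ hrange).trans
          (LinearEquiv.ofInjective _ (r'.emb_injective x hx)).symm)
      refine ⟨φ, fun h => absurd hx h, fun _ v => ?_⟩
      have : LinearEquiv.ofInjective _ (r'.emb_injective x hx) (φ v) =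
          LinearEquiv.ofEq _ _ hrange (LinearEquiv.ofInjective _ (r.emb_injective x hx) v) := by
        simp [φ]
      simpa using congrArg Subtype.val this
    · exact ⟨(r.away x hx).trans (r'.away x hx).symm, by simp, fun h => absurd h hx⟩
  choose φ h1 h2 using hloc
  refine ⟨φ, fun x y a m => ?_⟩
  have hy : y ∉ X := a.2.2 ▸ r.isReflected.tgt_notMem a.1
  apply (r'.away y hy).injective
  rw [h1]
  by_cases hx : x ∈ X
  · have := r.isReflected.of_src_mem a.1 (a.2.1.symm ▸ hx)
    let b : Q.Arrow y x := ⟨a.1, this.1.trans a.2.2, this.2.trans a.2.1⟩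
    rw [r.away_map_of_mem a b rfl hx, r'.away_map_of_mem a b rfl hx, h2]
  · have := r.isReflected.of_src_notMem a.1 (a.2.1.symm ▸ hx)
    let b : Q.Arrow x y := ⟨a.1, this.1.trans a.2.1, this.2.trans a.2.2⟩
    rw [r.away_map a b rfl hx, r'.away_map a b rfl hx, h1]

/-- Reflections are compatible with isomorphisms. -/
noncomputable def congr {M' : Rep k Q} (r : Reflection M X N) (φ : ∀ x, M.obj x ≃ₗ[k] M'.obj x)
    (hφ : ∀ (x y : V) (a : Q.Arrow x y) m, φ y (M.map a m) = M'.map a (φ x m)) :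
    Reflection M' X N where
  isReflected := r.isReflected
  away z hz := (r.away z hz).trans (φ z)
  emb x hx := (LinearMap.pi fun y => LinearMap.pi fun a =>
    (φ y).toLinearMap ∘ₗ LinearMap.proj a ∘ₗ LinearMap.proj y) ∘ₗ r.emb x hx
  emb_injective x hx v v' h := by
    apply r.emb_injective x hx
    ext y a
    exact (φ y).injective (congrFun (congrFun h y) a)
  exists_emb_iff x hx u := by
    have hinc : M'.incoming x u = φ x (M.incoming x fun y a => (φ y).symm (u y a)) := by
      simp [incoming_apply, map_sum, hφ]
    rw [hinc, LinearEquiv.map_eq_zero_iff, ← r.exists_emb_iff x hx]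
    refine exists_congr fun v => ⟨fun h => ?_, fun h => ?_⟩
    · ext y a
      rw [← h]
      simp
    · ext y a
      simp [h]
  away_map a b hab hy hz v := by simp [r.away_map a b hab hy hz, hφ]
  away_map_of_mem a b hab hx hz v := by simp [r.away_map_of_mem a b hab hx hz]

/-- The direct sum of two reflections. -/
noncomputable def prod {M' : Rep k Q} {N' : Rep k Q'} (r : Reflection M X N)
    (r' : Reflection M' X N') : Reflection (M.prod M') X (N.prod N') where
  isReflected := r.isReflected
  away z hz := (r.away z hz).prodCongr (r'.away z hz)
  emb x hx := LinearMap.pi fun y => LinearMap.pi fun a =>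
    (LinearMap.proj a ∘ₗ LinearMap.proj y ∘ₗ r.emb x hx).prodMap
      (LinearMap.proj a ∘ₗ LinearMap.proj y ∘ₗ r'.emb x hx)
  emb_injective x hx v v' h := by
    refine Prod.ext (r.emb_injective x hx ?_) (r'.emb_injective x hx ?_)
    · ext y a
      exact congrArg Prod.fst (congrFun (congrFun h y) a)
    · ext y a
      exact congrArg Prod.snd (congrFun (congrFun h y) a)
  exists_emb_iff x hx u := by
    have hinc : (M.prod M').incoming x u =
        (M.incoming x fun y a => (u y a).1, M'.incoming x fun y a => (u y a).2) := by
      refine Prod.ext ?_ ?_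
      · rw [incoming_apply, incoming_apply]
        exact (map_sum (LinearMap.fst k (M.obj x) (M'.obj x)) _ _).trans
          (Finset.sum_congr rfl fun y _ => map_sum (LinearMap.fst k (M.obj x) (M'.obj x)) _ _)
      · rw [incoming_apply, incoming_apply M']
        exact (map_sum (LinearMap.snd k (M.obj x) (M'.obj x)) _ _).trans
          (Finset.sum_congr rfl fun y _ => map_sum (LinearMap.snd k (M.obj x) (M'.obj x)) _ _)
    rw [hinc]
    refine Iff.trans ?_ (Prod.mk_eq_zero).symm
    rw [← r.exists_emb_iff x hx, ← r'.exists_emb_iff x hx]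
    constructor
    · rintro ⟨v, rfl⟩
      exact ⟨⟨v.1, rfl⟩, ⟨v.2, rfl⟩⟩
    · rintro ⟨⟨v, hv⟩, ⟨v', hv'⟩⟩
      refine ⟨(v, v'), ?_⟩
      ext y a
      exact Prod.ext (congrFun (congrFun hv y) a) (congrFun (congrFun hv' y) a)
  away_map a b hab hy hz v :=
    Prod.ext (r.away_map a b hab hy hz v.1) (r'.away_map a b hab hy hz v.2)
  away_map_of_mem a b hab hx hz v := by
    refine Prod.ext ?_ ?_
    · exact r.away_map_of_mem a b hab hx hz v.1
    · exact r'.away_map_of_mem a b hab hx hz v.2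

end Reflection

/-- The spaces of `F_x^+ M` away from `x`. -/
def plusAway (M : Rep k Q) (x z : V) (hz : z ≠ x) :
    ∀ d : Decidable (z = x), M.PlusObj x z d ≃ₗ[k] M.obj z
  | isTrue h => absurd h hz
  | isFalse _ => LinearEquiv.refl k (M.obj z)

/-- The space of `F_x^+ M` at `x`. -/
def plusKer (M : Rep k Q) (x : V) :
    ∀ d : Decidable (x = x), M.PlusObj x x d ≃ₗ[k] LinearMap.ker (M.incoming x)
  | isTrue _ => LinearEquiv.refl k (LinearMap.ker (M.incoming x))
  | isFalse h => absurd rfl h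

/-- The decisions `d`, `d'` are arbitrary because `PlusObj` and `plusMap` match on them; after
splitting them the identity is definitional. -/
theorem plusAway_plusMap (M : Rep k Q) {x : V} (hx : Q.IsSink x) {y z : V} (hy : y ≠ x)
    (hz : z ≠ x) (a : (Q.reflect x).Arrow y z) (b : Q.Arrow y z) (hab : a.1 = b.1)
    (d : Decidable (y = x)) (d' : Decidable (z = x)) (v : M.PlusObj x y d) :
    M.plusAway x z hz d' (M.plusMap hx a d d' v) = M.map b (M.plusAway x y hy d v) := by
  obtain d | d := d
  · obtain d' | d' := d'
    · obtain rfl : Arrow.unreflect hy hz a = b := Subtype.ext hab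
      rfl
    · exact absurd d' hz
  · exact absurd d hy

theorem plusAway_plusMap_self (M : Rep k Q) {x : V} (hx : Q.IsSink x) {z : V}
    (hz : z ≠ x) (a : (Q.reflect x).Arrow x z) (b : Q.Arrow z x) (hab : a.1 = b.1)
    (d : Decidable (x = x)) (d' : Decidable (z = x)) (v : M.PlusObj x x d) :
    M.plusAway x z hz d' (M.plusMap hx a d d' v) = (M.plusKer x d v).1 z b := by
  obtain d | d := d
  · exact absurd rfl d
  · obtain d' | d' := d'
    · obtain rfl : Arrow.unreverse hx a = b := Subtype.ext hab
      rfl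
    · exact absurd d' hz

/-- The map `(F_x^+ M)(z) → ⨁ M(y)` for `z = x`. -/
def plusEmb (M : Rep k Q) {x z : V} (hx : Q.IsSink x) (hz : z = x) :
    (M.plus x hx).obj z →ₗ[k] ∀ y : V, Q.Arrow y z → M.obj y := by
  subst hz
  exact (LinearMap.ker (M.incoming z)).subtype ∘ₗ (M.plusKer z (decEq z z)).toLinearMap

/-- `F_x^+ M` is the reflection of `M` at the single sink `x`. -/
def plusReflection (M : Rep k Q) (x : V) (hx : Q.IsSink x) :
    Reflection M {x} (M.plus x hx) where
  isReflected := isReflected_reflect hx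
  away z hz := M.plusAway x z hz (decEq z x)
  emb z hz := M.plusEmb hx hz
  emb_injective z hz := by
    obtain rfl : z = x := hz
    exact Subtype.val_injective.comp (M.plusKer z (decEq z z)).injective
  exists_emb_iff z hz u := by
    obtain rfl : z = x := hz
    constructor
    · rintro ⟨v, rfl⟩
      exact (M.plusKer z (decEq z z) v).2
    · intro hu
      refine ⟨(M.plusKer z (decEq z z)).symm ⟨u, hu⟩, ?_⟩
      exact congrArg Subtype.val ((M.plusKer z (decEq z z)).apply_symm_apply ⟨u, hu⟩)
  away_map a b hab hy hz v := M.plusAway_plusMap hx hy hz a b hab _ _ v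
  away_map_of_mem {z' z} a b hab hz' hz v := by
    obtain rfl : z' = x := hz'
    exact M.plusAway_plusMap_self hx hz a b hab _ _ v

end Rep

end FinQuiver

/-! ### Idempotent endomorphisms and composition of reflections -/

namespace FinQuiver
namespace Rep

section Endomorphisms

variable {V : Type u} {E : Type v} {k : Type w} [Field k] {Q : FinQuiver V E}

/-- `e` is an idempotent endomorphism of `M`. -/
structure IsIdempotent (M : Rep k Q) (e : ∀ x, M.obj x →ₗ[k] M.obj x) : Prop where
  comm : ∀ {x y : V} (a : Q.Arrow x y) m, e y (M.map a m) = M.map a (e x m)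
  idem : ∀ x m, e x (e x m) = e x m

/-- All idempotent endomorphisms of `M` are `0` or `1`. -/
def IdempotentsTrivial (M : Rep k Q) : Prop :=
  ∀ e, IsIdempotent M e → (∀ x m, e x m = 0) ∨ (∀ x m, e x m = m)

/-- The subrepresentation of a family of subspaces. -/
def sub (M : Rep k Q) (W : ∀ x, Submodule k (M.obj x))
    (hW : ∀ {x y : V} (a : Q.Arrow x y) m, m ∈ W x → M.map a m ∈ W y) : Rep k Q where
  obj x := W x
  map {_ _} a := (M.map a).restrict fun m hm => hW a m hm

/-- An idempotent splits `M` as image plus kernel, via `m ↦ (e m, m - e m)`. -/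
theorem Indecomposable.idempotentsTrivial {M : Rep k Q} (hM : M.Indecomposable) :
    M.IdempotentsTrivial := by
  intro e he
  let A := M.sub (fun x => LinearMap.range (e x)) fun {x y} a m hm => by
    obtain ⟨n, rfl⟩ := hm
    exact ⟨M.map a n, he.comm a n⟩
  let B := M.sub (fun x => LinearMap.ker (e x)) fun {x y} a m hm => by
    rw [LinearMap.mem_ker] at hm ⊢
    rw [he.comm, hm, map_zero]
  have hiso : M.Isomorphic (A.prod B) := by
    let φ : ∀ x, M.obj x →ₗ[k] LinearMap.range (e x) × LinearMap.ker (e x) := fun x =>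
      ((e x).rangeRestrict).prod ((LinearMap.id - e x).codRestrict _ fun m => by
        simp [he.idem])
    have hφ : ∀ x, Function.Bijective (φ x) := by
      intro x
      refine ⟨fun m n h => ?_, fun p => ?_⟩
      · have h1 : e x m = e x n := congrArg (fun p => p.1.1) h
        have h2 : m - e x m = n - e x n := congrArg (fun p => p.2.1) h
        rwa [h1, sub_left_inj] at h2
      · obtain ⟨⟨_, n, rfl⟩, ⟨m, hm⟩⟩ := p
        rw [LinearMap.mem_ker] at hm
        refine ⟨e x n + m, Prod.ext (Subtype.ext ?_) (Subtype.ext ?_)⟩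
        · simp [φ, he.idem, hm]
        · simp [φ, he.idem, hm]
    refine ⟨fun x => LinearEquiv.ofBijective (φ x) (hφ x), fun x y a m => ?_⟩
    refine Prod.ext (Subtype.ext ?_) (Subtype.ext ?_)
    · exact he.comm a m
    · change M.map a m - e y (M.map a m) = M.map a (m - e x m)
      rw [he.comm, map_sub]
  rcases hM.2 A B hiso with h | h
  · refine Or.inl fun x m => ?_
    have : Subsingleton (LinearMap.range (e x)) := h x
    exact congrArg Subtype.val
      (Subsingleton.elim (⟨e x m, ⟨m, rfl⟩⟩ : LinearMap.range (e x)) 0)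
  · refine Or.inr fun x m => ?_
    have : Subsingleton (LinearMap.ker (e x)) := h x
    have := congrArg Subtype.val (Subsingleton.elim
      (⟨m - e x m, by simp [he.idem]⟩ : LinearMap.ker (e x)) 0)
    exact (sub_eq_zero.1 this).symm

/-- A representation with trivial idempotents cannot be supported at two vertices that are not
joined. -/
theorem IdempotentsTrivial.not_support_pair {M : Rep k Q} (hM : M.IdempotentsTrivial) {x y : V}
    (hne : x ≠ y) (hxx : ¬ Q.Joined x x) (hxy : ¬ Q.Joined x y) (hx : ¬ Subsingleton (M.obj x))
    (hy : ¬ Subsingleton (M.obj y)) :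
    ¬ ∀ z, z ≠ x → z ≠ y → Subsingleton (M.obj z) := by
  classical
  intro hz
  have hadj : ∀ z, Q.Joined x z → Subsingleton (M.obj z) := fun z h =>
    hz z (fun h' => hxx (h' ▸ h)) fun h' => hxy (h' ▸ h)
  -- The projection onto the part at `x` commutes with the arrows because every neighbour of `x`
  -- carries the zero space.
  let e : ∀ z, M.obj z →ₗ[k] M.obj z := fun z => if z = x then LinearMap.id else 0
  have hex : e x = LinearMap.id := if_pos rfl
  have he0 : ∀ z, z ≠ x → e z = 0 := fun z h => if_neg h
  have he : IsIdempotent M e := by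
    refine ⟨fun {z z'} a m => ?_, fun z m => ?_⟩
    · by_cases h : z = x
      · subst h
        have := hadj z' ⟨a.1, Or.inl a.2⟩
        exact Subsingleton.elim _ _
      · by_cases h' : z' = x
        · subst h'
          have := hadj z ⟨a.1, Or.inr a.2⟩
          rw [Subsingleton.elim m 0]
          simp
        · simp [he0 _ h, he0 _ h']
    · by_cases h : z = x
      · subst h
        simp [hex]
      · simp [he0 _ h]
  rcases hM e he with h | h
  · refine hx (subsingleton_of_forall_eq 0 fun m => ?_)
    simpa [hex] using h x m
  · refine hy (subsingleton_of_forall_eq 0 fun m => ?_)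
    simpa [he0 _ hne.symm] using (h y m).symm

end Endomorphisms

variable {V : Type u} {E : Type v} {k : Type w} [Field k]
  [Fintype V] [DecidableEq V] [Fintype E] {Q Q' Q'' : FinQuiver V E} {M : Rep k Q}

open Classical in
theorem map_eq_incoming {x y : V} (a : Q.Arrow x y) (m : M.obj x) :
    M.map a m = M.incoming y (Pi.single x (Pi.single a m)) := by
  rw [incoming_apply, Finset.sum_eq_single x, Finset.sum_eq_single a] <;> simp +contextual

namespace Reflection

variable {X Y : Set V} {N : Rep k Q'} {P : Rep k Q''}

/-- Reflections at disjoint sets of sinks, no two of which are joined, compose. -/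
theorem comp (r : Reflection M X N) (r' : Reflection N Y P) (h : IsReflected Q Q'' (X ∪ Y))
    (hXY : Disjoint X Y) : Nonempty (Reflection M (X ∪ Y) P) := by
  have hsrc : ∀ {y z : V}, Q.Arrow y z → y ∉ X := fun a => a.2.1 ▸ r.isReflected.src_notMem a.1
  have hnX : ∀ {z}, z ∈ Y → z ∉ X := fun hz hz' => Set.disjoint_left.1 hXY hz' hz
  -- An arrow of `Q'` from `X` to `Y` would be an arrow of `Q` starting in `Y`, which `h` forbids.
  -- So the arrows into `Y` are untouched by the first reflection, and `θ` identifies them.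
  have hsrc' : ∀ {y z : V}, z ∈ Y → Q'.Arrow y z → y ∉ X := by
    intro y z hz a hy
    have := r.isReflected.of_src_mem a.1 (a.2.1.symm ▸ hy)
    exact h.src_notMem a.1 (Or.inr ((this.1.trans a.2.2).symm ▸ hz))
  let θ : ∀ (y z : V), z ∈ Y → (Q'.Arrow y z ≃ Q.Arrow y z) := fun y z hz =>
    { toFun := fun a => ⟨a.1, by
        have := r.isReflected.of_src_notMem a.1 (a.2.1.symm ▸ hsrc' hz a)
        exact ⟨this.1.trans a.2.1, this.2.trans a.2.2⟩⟩
      invFun := fun a => ⟨a.1, by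
        have := r.isReflected.of_tgt_notMem (a := a.1) (a.2.2.symm ▸ hnX hz)
        exact ⟨this.1.trans a.2.1, this.2.trans a.2.2⟩⟩
      left_inv := fun _ => rfl
      right_inv := fun _ => rfl }
  -- On `Y` the embedding is that of `r'`, read in `M` through `r.away`; on `X` it is that of `r`,
  -- preceded by `r'.away`.
  have hloc : ∀ z (hz : z ∈ X ∪ Y), ∃ f : P.obj z →ₗ[k] ∀ y : V, Q.Arrow y z → M.obj y,
      (∀ hX hY v, f v = r.emb z hX (r'.away z hY v)) ∧
      (∀ hY v y a hy, f v y (θ y z hY a) = r.away y hy (r'.emb z hY v y a)) := by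
    intro z hz
    by_cases hY : z ∈ Y
    · refine ⟨LinearMap.pi fun y => LinearMap.pi fun a => (r.away y (hsrc a)).toLinearMap ∘ₗ
        LinearMap.proj ((θ y z hY).symm a) ∘ₗ LinearMap.proj y ∘ₗ r'.emb z hY,
        fun _ h => absurd hY h, fun _ v y a hy => ?_⟩
      simp
    · exact ⟨r.emb z (hz.resolve_right hY) ∘ₗ (r'.away z hY).toLinearMap, fun _ _ _ => rfl,
        fun h => absurd h hY⟩
  choose f hf hf' using hloc
  refine ⟨⟨h, fun z hz => (r'.away z fun h => hz (Or.inr h)).trans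
    (r.away z fun h => hz (Or.inl h)), f, ?_, ?_, ?_, ?_⟩⟩
  · intro z hz v v' hv
    by_cases hY : z ∈ Y
    · apply r'.emb_injective z hY
      ext y a
      apply (r.away y (hsrc' hY a)).injective
      rw [← hf' z hz, ← hf' z hz, hv]
    · have hX := hz.resolve_right hY
      rw [hf z hz hX hY, hf z hz hX hY] at hv
      exact (r'.away z hY).injective (r.emb_injective z hX hv)
  · intro z hz u
    by_cases hY : z ∈ Y
    · let u' : ∀ y : V, Q'.Arrow y z → N.obj y := fun y a =>
        (r.away y (hsrc' hY a)).symm (u y (θ y z hY a))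
      have hinc : M.incoming z u = r.away z (hnX hY) (N.incoming z u') := by
        simp only [incoming_apply, map_sum]
        refine Finset.sum_congr rfl fun y _ => ?_
        rw [← Equiv.sum_comp (θ y z hY)]
        refine Finset.sum_congr rfl fun a _ => ?_
        rw [r.away_map a (θ y z hY a) rfl (hsrc' hY a)]
        simp [u']
      rw [hinc, LinearEquiv.map_eq_zero_iff, ← r'.exists_emb_iff z hY]
      refine exists_congr fun v => ⟨fun hv => ?_, fun hv => ?_⟩
      · ext y a
        simp only [u']
        rw [← hv, hf' z hz hY v y a (hsrc' hY a), LinearEquiv.symm_apply_apply]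
      · ext y a
        obtain ⟨a, rfl⟩ := (θ y z hY).surjective a
        rw [hf' z hz hY v y a (hsrc' hY a), hv]
        simp [u']
    · have hX := hz.resolve_right hY
      rw [← r.exists_emb_iff z hX]
      constructor
      · rintro ⟨v, rfl⟩
        exact ⟨_, (hf z hz hX hY v).symm⟩
      · rintro ⟨v, rfl⟩
        exact ⟨(r'.away z hY).symm v, by rw [hf z hz hX hY, LinearEquiv.apply_symm_apply]⟩
  · intro y z a b hab hy hz v
    rw [Set.mem_union, not_or] at hy hz
    have := r'.isReflected.of_src_notMem a.1 (a.2.1.symm ▸ hy.2)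
    let c : Q'.Arrow y z := ⟨a.1, this.1.trans a.2.1, this.2.trans a.2.2⟩
    simp only [LinearEquiv.trans_apply]
    rw [r'.away_map a c rfl hy.2, r.away_map c b hab hy.1]
  · intro x z a b hab hx hz v
    rw [Set.mem_union, not_or] at hz
    simp only [LinearEquiv.trans_apply]
    by_cases hY : x ∈ Y
    · have := r'.isReflected.of_src_mem a.1 (a.2.1.symm ▸ hY)
      let c : Q'.Arrow z x := ⟨a.1, this.1.trans a.2.2, this.2.trans a.2.1⟩
      obtain rfl : θ z x hY c = b := Subtype.ext hab
      rw [r'.away_map_of_mem a c rfl hY, ← hf' x hx]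
    · have hX := hx.resolve_right hY
      have := r'.isReflected.of_src_notMem a.1 (a.2.1.symm ▸ hY)
      let c : Q'.Arrow x z := ⟨a.1, this.1.trans a.2.1, this.2.trans a.2.2⟩
      rw [r'.away_map a c rfl hY, r.away_map_of_mem c b hab hX, hf x hx hX hY]

/-- Idempotent endomorphisms lift along reflections. -/
theorem exists_lift (r : Reflection M X N) {e' : ∀ x, N.obj x →ₗ[k] N.obj x}
    (he' : IsIdempotent N e') : ∃ e, IsIdempotent M e ∧
      (∀ z hz v, r.away z hz (e' z v) = e z (r.away z hz v)) ∧
      (∀ x hx v y a, r.emb x hx (e' x v) y a = e y (r.emb x hx v y a)) := by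
  have hsrc : ∀ {y z : V}, Q.Arrow y z → y ∉ X := fun a => a.2.1 ▸ r.isReflected.src_notMem a.1
  let c : ∀ y, y ∉ X → (M.obj y →ₗ[k] M.obj y) := fun y hy =>
    (r.away y hy).toLinearMap ∘ₗ e' y ∘ₗ (r.away y hy).symm.toLinearMap
  have hc : ∀ y hy m, c y hy (c y hy m) = c y hy m := by simp [c, he'.idem]
  have hcmap : ∀ {y z : V} (a : Q.Arrow y z) hy hz m,
      c z hz (M.map a m) = M.map a (c y hy m) := by
    intro y z a hy hz m
    obtain ⟨m, rfl⟩ := (r.away y hy).surjective m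
    have := r.isReflected.of_tgt_notMem (a := a.1) (a.2.2.symm ▸ hz)
    let b : Q'.Arrow y z := ⟨a.1, this.1.trans a.2.1, this.2.trans a.2.2⟩
    rw [← r.away_map b a rfl hy hz]
    simp only [c, LinearMap.comp_apply, LinearEquiv.coe_coe, LinearEquiv.symm_apply_apply]
    rw [he'.comm, r.away_map b a rfl hy hz]
  have hcemb : ∀ x hx v y a, r.emb x hx (e' x v) y a = c y (hsrc a) (r.emb x hx v y a) := by
    intro x hx v y a
    have := r.isReflected.of_tgt_mem (a := a.1) (a.2.2.symm ▸ hx)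
    let b : Q'.Arrow x y := ⟨a.1, this.1.trans a.2.2, this.2.trans a.2.1⟩
    rw [← r.away_map_of_mem b a rfl hx (hsrc a), ← r.away_map_of_mem b a rfl hx (hsrc a)]
    simp [c, he'.comm]
  have hloc : ∀ x, ∃ e : M.obj x →ₗ[k] M.obj x, (∀ m, e (e m) = e m) ∧
      (∀ hx m, e m = c x hx m) ∧ (x ∈ X → ∀ u : ∀ y : V, Q.Arrow y x → M.obj y,
        e (M.incoming x u) = M.incoming x fun y a => c y (hsrc a) (u y a)) := by
    intro x
    by_cases hx : x ∈ X
    · let T : (∀ y : V, Q.Arrow y x → M.obj y) →ₗ[k] (∀ y : V, Q.Arrow y x → M.obj y) :=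
        LinearMap.pi fun y => LinearMap.pi fun a =>
          c y (hsrc a) ∘ₗ LinearMap.proj a ∘ₗ LinearMap.proj y
      have hT : ∀ u, T (T u) = T u := fun u => by
        ext y a
        exact hc y (hsrc a) (u y a)
      -- The kernel is the image of `N.obj x`, on which `T` acts as `e' x`. Hence `T` descends to
      -- the range of `incoming`.
      have hker : ∀ u, M.incoming x u = 0 → M.incoming x (T u) = 0 := by
        intro u hu
        obtain ⟨v, rfl⟩ := (r.exists_emb_iff x hx u).2 hu
        refine (r.exists_emb_iff x hx _).1 ⟨e' x v, ?_⟩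
        ext y a
        exact hcemb x hx v y a
      -- `incoming` need not be surjective, so a section over its range is extended arbitrarily to
      -- `g`. By `key`, `incoming ∘ T ∘ g` induces `T` on the range; as its values lie there, it is
      -- idempotent whatever the extension.
      obtain ⟨s, hs⟩ := (M.incoming x).rangeRestrict.exists_rightInverse_of_surjective
        (LinearMap.range_rangeRestrict _)
      obtain ⟨g, hg⟩ := LinearMap.exists_extend s
      have hgu : ∀ u, M.incoming x (g (M.incoming x u)) = M.incoming x u := by
        intro u
        have h1 : g (M.incoming x u) = s ((M.incoming x).rangeRestrict u) := by
          rw [← hg]; rfl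
        rw [h1]
        exact congrArg Subtype.val (LinearMap.congr_fun hs ((M.incoming x).rangeRestrict u))
      have key : ∀ u, M.incoming x (T (g (M.incoming x u))) = M.incoming x (T u) := by
        intro u
        rw [← sub_eq_zero, ← map_sub, ← map_sub]
        apply hker
        rw [map_sub, hgu, sub_self]
      refine ⟨M.incoming x ∘ₗ T ∘ₗ g, fun m => ?_, fun h => absurd hx h, fun _ u => key u⟩
      simp only [LinearMap.comp_apply]
      rw [key, hT]
    · exact ⟨c x hx, hc x hx, fun _ _ => rfl, fun h => absurd h hx⟩
  choose e he hec hei using hloc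
  refine ⟨e, ⟨fun {x y} a m => ?_, he⟩, fun z hz v => ?_, fun x hx v y a => ?_⟩
  · have hx : x ∉ X := hsrc a
    by_cases hy : y ∈ X
    · rw [map_eq_incoming, hei y hy, hec x hx, map_eq_incoming]
      congr 1
      ext z b
      by_cases hz : z = x
      · subst hz
        by_cases hb : b = a
        · subst hb; simp
        · simp [hb]
      · simp [hz]
    · rw [hec y hy, hec x hx, hcmap a hx hy]
  · rw [hec z hz]
    simp [c]
  · rw [hec y (hsrc a), hcemb]

/-- A lifted idempotent is 0 or 1, and `away` together with the injective `emb` carries this back to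
`N`. Only this consequence of indecomposability is propagated along reflections. -/
theorem idempotentsTrivial (r : Reflection M X N) (hM : M.IdempotentsTrivial) :
    N.IdempotentsTrivial := by
  intro e' he'
  obtain ⟨e, he, h1, h2⟩ := r.exists_lift he'
  refine (hM e he).imp (fun h x m => ?_) fun h x m => ?_
  all_goals
    by_cases hx : x ∈ X
    · apply r.emb_injective x hx
      ext y a
      rw [h2, h]
      try simp
    · apply (r.away x hx).injective
      rw [h1, h]
      try simp

end Reflection

end Rep
end FinQuiver

namespace FinQuiver
namespace Rep

variable {V : Type u} {E : Type v} {k : Type w} [Field k]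
  [Fintype V] [DecidableEq V] [Fintype E] {Q Q' Q'' : FinQuiver V E} {M : Rep k Q}

/-! ### Reflection functors along admissible sequences -/

theorem Reflection.hiso {X : Set V} {N : Rep k Q'} {N' : Rep k Q''} (r : Reflection M X N)
    (r' : Reflection M X N') (h : Q' = Q'') : HIso N N' := by
  subst h
  exact hiso_iff_isomorphic.2 (r.isomorphic r')

theorem HIso.plus {N : Rep k Q'} (h : HIso M N) {x : V} (hx : Q.IsSink x) (hx' : Q'.IsSink x) :
    HIso (M.plus x hx) (N.plus x hx') := by
  obtain rfl := h.1
  obtain ⟨φ, hφ⟩ := hiso_iff_isomorphic.1 h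
  exact ((M.plusReflection x hx).congr φ hφ).hiso (N.plusReflection x hx') rfl

/-- Both composites are reflections of `M` at the set consisting of `x` and `y`, hence isomorphic.
The two target quivers are equal only propositionally, whence `HIso`. -/
theorem hiso_plus_plus (M : Rep k Q) {x y : V} (hne : x ≠ y) (hxy : ¬ Q.Joined x y)
    (hx : Q.IsSink x) (hy : (Q.reflect x).IsSink y) (hy' : Q.IsSink y)
    (hx' : (Q.reflect y).IsSink x) :
    HIso ((M.plus x hx).plus y hy) ((M.plus y hy').plus x hx') := by
  have hyx : ¬ Q.Joined y x := fun ⟨a, h⟩ => hxy ⟨a, h.symm⟩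
  obtain ⟨r⟩ := (M.plusReflection x hx).comp ((M.plus x hx).plusReflection y hy)
    (isReflected_reflect_reflect hx hy hne hxy) (by simpa using hne)
  obtain ⟨r'⟩ := (M.plusReflection y hy').comp ((M.plus y hy').plusReflection x hx')
    (isReflected_reflect_reflect hy' hx' hne.symm hyx) (by simpa using hne.symm)
  rw [Set.union_comm] at r'
  exact r.hiso r' (reflect_comm Q x y)

theorem HIso.plusSeq (S : List V) : ∀ {Q Q' : FinQuiver V E} {M : Rep k Q} {N : Rep k Q'},
    HIso M N → ∀ (h : Q.Admissible S) (h' : Q'.Admissible S),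
    HIso (plusSeq S M h) (plusSeq S N h') := by
  induction S with
  | nil => exact fun h _ _ => h
  | cons x S ih => exact fun h h1 h2 => ih (h.plus h1.1 h2.1) h1.2 h2.2

theorem hiso_plusSeq_append (S U : List V) : ∀ {Q : FinQuiver V E} (M : Rep k Q)
    (h : Q.Admissible (S ++ U)) (h1 : Q.Admissible S) (h2 : (Q.reflectSeq S).Admissible U),
    HIso (plusSeq (S ++ U) M h) (plusSeq U (plusSeq S M h1) h2) := by
  induction S with
  | nil => exact fun M _ _ _ => HIso.refl _
  | cons x S ih => exact fun M h h1 h2 => ih (M.plus x h.1) h.2 h1.2 h2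

theorem hiso_plusSeq_swap (A B : List V) {x y : V} : ∀ {Q : FinQuiver V E} (M : Rep k Q),
    x ≠ y → ¬ Q.Joined x y → ∀ (h : Q.Admissible (A ++ x :: y :: B))
    (h' : Q.Admissible (A ++ y :: x :: B)),
    HIso (plusSeq (A ++ x :: y :: B) M h) (plusSeq (A ++ y :: x :: B) M h') := by
  induction A with
  | nil =>
    intro Q M hne hxy h h'
    exact (hiso_plus_plus M hne hxy h.1 h.2.1 h'.1 h'.2.1).plusSeq B h.2.2 h'.2.2
  | cons z A ih =>
    intro Q M hne hxy h h'
    exact ih (M.plus z h.1) hne (by rwa [joined_reflect]) h.2 h'.2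

theorem hiso_plusSeq_of_seqEquiv (M : Rep k Q) {S T : List V} (hST : Q.SeqEquiv S T)
    (hS : Q.Admissible S) (hT : Q.Admissible T) :
    HIso (plusSeq S M hS) (plusSeq T M hT) := by
  induction hST with
  | refl => exact HIso.refl _
  | tail _ h ih =>
    refine (ih h.1).trans ?_
    obtain ⟨h1, h2, A, B, x, y, hxy, rfl, rfl⟩ := h
    -- `Swap` admits `x = y`, in which case nothing changes.
    by_cases hne : x = y
    · subst hne
      exact HIso.refl _
    · exact hiso_plusSeq_swap A B M hne hxy h1 h2

theorem nonempty_plusSeq_equiv_of_notMem {z : V} {U : List V} (hz : z ∉ U) :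
    ∀ {Q : FinQuiver V E} (M : Rep k Q) (h : Q.Admissible U),
    Nonempty ((plusSeq U M h).obj z ≃ₗ[k] M.obj z) := by
  induction U with
  | nil => exact fun M _ => ⟨LinearEquiv.refl k _⟩
  | cons x U ih =>
    intro Q M h
    rw [List.mem_cons, not_or] at hz
    obtain ⟨φ⟩ := ih hz.2 (M.plus x h.1) h.2
    exact ⟨φ.trans ((M.plusReflection x h.1).away z hz.1)⟩

/-- The space of `F(S)M` at `z` depends only on the multiplicity of `z` in `S`. -/
theorem nonempty_plusSeq_equiv (hQ : Q.Acyclic) (M : Rep k Q) {S T : List V}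
    (hS : Q.Admissible S) (hT : Q.Admissible T) {z : V} (h : S.count z = T.count z) :
    Nonempty ((plusSeq S M hS).obj z ≃ₗ[k] (plusSeq T M hT).obj z) := by
  obtain ⟨W, hW, hWc⟩ := ((admissibleVec_count hS).min
    (admissibleVec_count hT)).exists_admissible hQ
  -- Both sequences are compared with their minimum `W`. In `R ∼ WU` the sequence `U` avoids `z`,
  -- and so leaves the space at `z` alone.
  have key : ∀ (R : List V) (hR : Q.Admissible R), (∀ v, W.count v ≤ R.count v) →
      W.count z = R.count z → Nonempty ((plusSeq R M hR).obj z ≃ₗ[k] (plusSeq W M hW).obj z) := by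
    intro R hR hle hz
    obtain ⟨U, hU, hRU⟩ := (seqLE_iff hQ hW hR).2 hle
    have hWU := admissible_append.2 ⟨hW, hU⟩
    obtain ⟨φ⟩ := ((hiso_plusSeq_of_seqEquiv M hRU hR hWU).trans
      (hiso_plusSeq_append W U M hWU hW hU)).nonempty_equiv z
    have hzU : z ∉ U := by
      have := hRU.count_eq z
      rw [List.count_append] at this
      rw [← List.count_eq_zero]
      omega
    obtain ⟨ψ⟩ := nonempty_plusSeq_equiv_of_notMem hzU (plusSeq W M hW) hU
    exact ⟨φ.trans ψ⟩
  obtain ⟨φ⟩ := key S hS (fun v => by rw [hWc]; omega) (by rw [hWc]; omega)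
  obtain ⟨ψ⟩ := key T hT (fun v => by rw [hWc]; omega) (by rw [hWc]; omega)
  exact ⟨φ.trans ψ.symm⟩

theorem IsZero.plus (hM : M.IsZero) {x : V} (hx : Q.IsSink x) : (M.plus x hx).IsZero := by
  intro z
  let r := M.plusReflection x hx
  by_cases hz : z ∈ ({x} : Set V)
  · have := hM
    have : Subsingleton (∀ y : V, Q.Arrow y z → M.obj y) :=
      ⟨fun u u' => by ext y a; exact (hM y).elim _ _⟩
    exact (r.emb_injective z hz).subsingleton
  · have := hM z
    exact (r.away z hz).injective.subsingleton

theorem IsZero.plusSeq (S : List V) : ∀ {Q : FinQuiver V E} {M : Rep k Q}, M.IsZero →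
    ∀ h : Q.Admissible S, (plusSeq S M h).IsZero := by
  induction S with
  | nil => exact fun h _ => h
  | cons x S ih => exact fun h hS => ih (h.plus hS.1) hS.2

theorem IdempotentsTrivial.plusSeq (S : List V) : ∀ {Q : FinQuiver V E} {M : Rep k Q},
    M.IdempotentsTrivial → ∀ h : Q.Admissible S, (plusSeq S M h).IdempotentsTrivial := by
  induction S with
  | nil => exact fun h _ => h
  | cons x S ih => exact fun {_ M} h hS => ih ((M.plusReflection x hS.1).idempotentsTrivial h) hS.2

theorem hiso_plusSeq_prod (S : List V) : ∀ {Q : FinQuiver V E} (A B : Rep k Q)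
    (h : Q.Admissible S), HIso (plusSeq S (A.prod B) h) ((plusSeq S A h).prod (plusSeq S B h)) := by
  induction S with
  | nil => exact fun A B _ => HIso.refl _
  | cons x S ih =>
    intro Q A B h
    have h1 : HIso ((A.prod B).plus x h.1) ((A.plus x h.1).prod (B.plus x h.1)) :=
      ((A.prod B).plusReflection x h.1).hiso
        ((A.plusReflection x h.1).prod (B.plusReflection x h.1)) rfl
    exact (h1.plusSeq S h.2 h.2).trans (ih (A.plus x h.1) (B.plus x h.1) h.2)

/-! ### Annihilating sequences -/

theorem annihilates_iff {S : List V} (hS : Q.Admissible S) :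
    Annihilates S M ↔ (plusSeq S M hS).IsZero := ⟨fun ⟨_, h⟩ => h, fun h => ⟨hS, h⟩⟩

theorem annihilates_nil : Annihilates [] M ↔ M.IsZero := ⟨fun ⟨_, h⟩ => h, fun h => ⟨trivial, h⟩⟩

theorem Isomorphic.annihilates {N : Rep k Q} (h : M.Isomorphic N) {S : List V}
    (hS : Annihilates S M) : Annihilates S N :=
  ⟨hS.1, ((hiso_iff_isomorphic.2 h).plusSeq S hS.1 hS.1).isZero_iff.1 hS.2⟩

theorem annihilates_prod {A B : Rep k Q} {S : List V} :
    Annihilates S (A.prod B) ↔ Annihilates S A ∧ Annihilates S B := by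
  by_cases hS : Q.Admissible S
  · rw [annihilates_iff hS, annihilates_iff hS, annihilates_iff hS,
      (hiso_plusSeq_prod S A B hS).isZero_iff, isZero_prod]
  · exact ⟨fun h => absurd h.1 hS, fun h => absurd h.1.1 hS⟩

theorem IsSummand.annihilates {X : Rep k Q} (h : X.IsSummand M) {S : List V}
    (hS : Annihilates S M) : Annihilates S X :=
  let ⟨_, hC⟩ := h
  (annihilates_prod.1 (hC.annihilates hS)).1

theorem annihilates_directSum {S : List V} (hS : Q.Admissible S) : ∀ {t : ℕ}
    (N : Fin t → Rep k Q), Annihilates S (directSum N) ↔ ∀ i, Annihilates S (N i) := by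
  intro t
  induction t with
  | zero =>
    intro N
    refine iff_of_true ((annihilates_iff hS).2 (IsZero.plusSeq S (fun x => ?_) hS))
      fun i => i.elim0
    exact inferInstanceAs (Subsingleton (∀ i, (N i).obj x))
  | succ t ih =>
    intro N
    rw [Fin.forall_fin_succ, ← ih, ← annihilates_prod]
    exact ⟨(directSum_succ N).annihilates, (directSum_succ N).symm.annihilates⟩

theorem annihilates_power {S : List V} (hS : Q.Admissible S) {m : ℕ} (hm : 0 < m) :
    Annihilates S (M.power m) ↔ Annihilates S M :=
  (annihilates_directSum hS _).trans ⟨fun h => h ⟨0, hm⟩, fun h _ => h⟩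

/-- Here `T ∼ SU`, and reflection functors send zero to zero. -/
theorem Annihilates.mono (hQ : Q.Acyclic) {S T : List V} (hS : Annihilates S M)
    (hT : Q.Admissible T) (h : ∀ v, S.count v ≤ T.count v) : Annihilates T M := by
  obtain ⟨U, hU, hTU⟩ := (seqLE_iff hQ hS.1 hT).2 h
  have hSU := admissible_append.2 ⟨hS.1, hU⟩
  refine ⟨hT, ?_⟩
  rw [(hiso_plusSeq_of_seqEquiv M hTU hT hSU).isZero_iff,
    (hiso_plusSeq_append S U M hSU hS.1 hU).isZero_iff]
  exact hS.2.plusSeq U hU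

/-- At each vertex the minimum agrees with `S` or with `T`, so its space there is isomorphic to one
that vanishes. -/
theorem Annihilates.exists_min (hQ : Q.Acyclic) {S T : List V} (hS : Annihilates S M)
    (hT : Annihilates T M) :
    ∃ W, Annihilates W M ∧ ∀ v, W.count v = min (S.count v) (T.count v) := by
  obtain ⟨W, hW, hWc⟩ := ((admissibleVec_count hS.1).min
    (admissibleVec_count hT.1)).exists_admissible hQ
  refine ⟨W, ⟨hW, fun z => ?_⟩, hWc⟩
  rcases min_choice (S.count z) (T.count z) with h | h
  · obtain ⟨φ⟩ := nonempty_plusSeq_equiv hQ M hW hS.1 ((hWc z).trans h)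
    have := hS.2 z
    exact φ.injective.subsingleton
  · obtain ⟨φ⟩ := nonempty_plusSeq_equiv hQ M hW hT.1 ((hWc z).trans h)
    have := hT.2 z
    exact φ.injective.subsingleton

/-- Closure under minima turns a minimal annihilating sequence into a least one. -/
theorem isShortest_iff (hQ : Q.Acyclic) {S : List V} : IsShortest S M ↔
    Annihilates S M ∧ ∀ T, Annihilates T M → ∀ v, S.count v ≤ T.count v := by
  constructor
  · rintro ⟨hS, hmin⟩
    refine ⟨hS, fun T hT v => ?_⟩
    obtain ⟨W, hW, hWc⟩ := hS.exists_min hQ hT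
    have := (hmin W ((seqLE_iff hQ hW.1 hS.1).2 fun v => by rw [hWc]; omega) hW).count_eq v
    rw [hWc] at this
    omega
  · rintro ⟨hS, hmin⟩
    refine ⟨hS, fun T hTS hT => seqEquiv_of_count_eq hT.1 hS.1 fun v => le_antisymm ?_ ?_⟩
    · exact (seqLE_iff hQ hT.1 hS.1).1 hTS v
    · exact hmin T hT v

theorem IsShortest.admissible {S : List V} (h : IsShortest S M) : Q.Admissible S := h.1.1

theorem IsShortest.le (hQ : Q.Acyclic) {S T : List V} (h : IsShortest S M)
    (hT : Annihilates T M) (v : V) : S.count v ≤ T.count v :=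
  ((isShortest_iff hQ).1 h).2 T hT v

theorem IsShortest.count_eq (hQ : Q.Acyclic) {S T : List V} (h : IsShortest S M)
    (hT : IsShortest T M) (v : V) : S.count v = T.count v :=
  le_antisymm (h.le hQ hT.1 v) (hT.le hQ h.1 v)

/-- An annihilating sequence of smallest length works: its minimum with any other one also
annihilates, so it cannot be shorter. -/
theorem Preprojective.exists_isShortest (hQ : Q.Acyclic) (hM : M.Preprojective) :
    ∃ S, IsShortest S M := by
  let f : {S : List V // Annihilates S M} → ℕ := fun S => ∑ v, S.1.count v
  have : Nonempty {S : List V // Annihilates S M} := nonempty_subtype.2 hM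
  obtain ⟨S, hS⟩ : ∃ S, ∀ T, f S ≤ f T :=
    ⟨Function.argmin f, fun T => Function.argmin_le f T⟩
  refine ⟨S.1, (isShortest_iff hQ).2 ⟨S.2, fun T hT => ?_⟩⟩
  obtain ⟨W, hW, hWc⟩ := S.2.exists_min hQ hT
  have hle : ∀ v ∈ Finset.univ, W.count v ≤ S.1.count v := fun v _ => by rw [hWc]; omega
  have heq := (Finset.sum_eq_sum_iff_of_le hle).1 (le_antisymm (Finset.sum_le_sum hle) (hS ⟨W, hW⟩))
  intro v
  rw [← heq v (Finset.mem_univ v), hWc]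
  omega

/-! ### Indecomposable summands -/

/-- If the shortest sequence annihilating `M` ends in `y`, then the last but one of the modules
`F(S')M` does not vanish at `y`. -/
theorem IsShortest.not_subsingleton (hQ : Q.Acyclic) {S S' : List V} {y : V}
    (hS : IsShortest S M) (hS' : Q.Admissible S')
    (h : ∀ v, S.count v = (S' ++ [y]).count v) : ¬ Subsingleton ((plusSeq S' M hS').obj y) := by
  intro hy
  have hann : Annihilates S' M := by
    refine ⟨hS', fun z => ?_⟩
    by_cases hz : z = y
    · exact hz ▸ hy
    · obtain ⟨φ⟩ := nonempty_plusSeq_equiv hQ M hS' hS.admissible (z := z) (by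
        rw [h, List.count_append, List.count_singleton]; simp [Ne.symm hz])
      have := hS.1.2 z
      exact φ.injective.subsingleton
  have := hS.le hQ hann y
  rw [h, List.count_append, List.count_singleton_self] at this
  omega

/-- The shortest sequence annihilating an indecomposable module is join-prime. -/
theorem Indecomposable.exists_joinPrime (hQ : Q.Acyclic) (hM : M.Indecomposable) {S : List V}
    (hS : IsShortest S M) : ∃ x, 0 < S.count x ∧ ∀ T, Q.Admissible T →
      S.count x ≤ T.count x → ∀ v, S.count v ≤ T.count v := by
  have hSne : ∃ v, 0 < S.count v := by
    by_contra! h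
    have : S = [] := List.eq_nil_iff_forall_not_mem.2 fun v =>
      List.count_eq_zero.1 (Nat.le_zero.1 (h v))
    subst this
    exact hM.1 (annihilates_nil.1 hS.1)
  obtain ⟨v, hv⟩ := hSne
  -- The deciding vertex `x` is a possible last member of `S`. A counterexample `T` produces a
  -- second one, `y`, at which `T` falls short of `S`.
  obtain ⟨A, x, hA, hAc, hx⟩ := exists_concat_of_lt hQ hS.admissible (T := []) trivial
    (fun v => by simp) hv
  have hx0 : 0 < S.count x := by simpa using hx
  refine ⟨x, hx0, fun T hT hxT v => ?_⟩
  by_contra! hvT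
  obtain ⟨T', hT', hTc⟩ := ((admissibleVec_count hS.admissible).min
    (admissibleVec_count hT)).exists_admissible hQ
  obtain ⟨B, y, hB, hBc, hy⟩ := exists_concat_of_lt hQ hS.admissible hT'
    (fun v => by rw [hTc]; omega) (v := v) (by rw [hTc]; omega)
  have hne : x ≠ y := by
    rintro rfl
    rw [hTc] at hy
    omega
  have hA1 : ∀ z, z ≠ x → A.count z = S.count z := fun z hz => by
    rw [hAc, List.count_append, List.count_singleton]; simp [hz.symm]
  have hB1 : ∀ z, z ≠ y → B.count z = S.count z := fun z hz => by
    rw [hBc, List.count_append, List.count_singleton]; simp [hz.symm]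
  have hA2 : A.count x + 1 = S.count x := by
    rw [hAc, List.count_append, List.count_singleton_self]
  have hB2 : B.count y + 1 = S.count y := by
    rw [hBc, List.count_append, List.count_singleton_self]
  -- Since each of `x` and `y` can be dropped from `S` on its own, an arrow between them would
  -- impose contradictory inequalities.
  have hxy : ¬ Q.Joined x y := by
    rintro ⟨a, ⟨h1, h2⟩ | ⟨h1, h2⟩⟩
    all_goals
      have hAa := admissibleVec_count hA a
      have hBa := admissibleVec_count hB a
      simp only [h1, h2, hA1 y hne.symm, hB1 x hne] at hAa hBa
      omega
  have hxx : ¬ Q.Joined x x := by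
    rintro ⟨a, h | h⟩
    all_goals exact hQ x (.single ⟨a, h⟩)
  -- `W` is `S` with one `x` and one `y` dropped. Its image of `M` agrees with that of `A` at `x`,
  -- of `B` at `y`, and of `S` elsewhere, so its support is exactly these two vertices.
  obtain ⟨W, hW, hWc⟩ := ((admissibleVec_count hA).min
    (admissibleVec_count hB)).exists_admissible hQ
  refine (hM.idempotentsTrivial.plusSeq W hW).not_support_pair hne
    (by rwa [joined_reflectSeq]) (by rwa [joined_reflectSeq]) ?_ ?_ fun z hzx hzy => ?_
  · obtain ⟨φ⟩ := nonempty_plusSeq_equiv hQ M hW hA (z := x) (by rw [hWc, hB1 x hne]; omega)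
    rw [φ.toEquiv.subsingleton_congr]
    exact hS.not_subsingleton hQ hA hAc
  · obtain ⟨φ⟩ := nonempty_plusSeq_equiv hQ M hW hB (z := y) (by rw [hWc, hA1 y hne.symm]; omega)
    rw [φ.toEquiv.subsingleton_congr]
    exact hS.not_subsingleton hQ hB hBc
  · obtain ⟨φ⟩ := nonempty_plusSeq_equiv hQ M hW hS.admissible (z := z)
      (by rw [hWc, hA1 z hzx, hB1 z hzy, min_self])
    have := hS.1.2 z
    exact φ.injective.subsingleton

/-- Each multiplicity in the shortest sequence annihilating a module is attained by an
indecomposable summand. -/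
theorem IsShortest.exists_summand (hQ : Q.Acyclic) (n : ℕ) : ∀ {M : Rep k Q},
    ∑ x, Module.finrank k (M.obj x) ≤ n → ¬ M.IsZero → ∀ {S : List V}, IsShortest S M →
    ∀ x, ∃ (Y : Rep k Q) (T : List V), Y.Indecomposable ∧ Y.IsSummand M ∧ IsShortest T Y ∧
      T.count x = S.count x := by
  induction n with
  | zero =>
    intro M hn hM
    have := finrank_pos_of_not_isZero hM
    omega
  | succ n ih =>
    intro M hn hM S hS x
    by_cases hind : M.Indecomposable
    · exact ⟨M, S, hind, M.isSummand_self, hS, rfl⟩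
    · have : ∃ A B : Rep k Q, M.Isomorphic (A.prod B) ∧ ¬ A.IsZero ∧ ¬ B.IsZero := by
        by_contra! h
        exact hind ⟨hM, fun A B hAB => or_iff_not_imp_left.2 (h A B hAB)⟩
      obtain ⟨A, B, hAB, hA, hB⟩ := this
      have hdim : ∑ x, Module.finrank k (M.obj x) =
          ∑ x, Module.finrank k (A.obj x) + ∑ x, Module.finrank k (B.obj x) := by
        obtain ⟨φ, -⟩ := hAB
        rw [← Finset.sum_add_distrib]
        refine Finset.sum_congr rfl fun x _ => ?_
        rw [(φ x).finrank_eq]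
        exact Module.finrank_prod
      have hA0 := finrank_pos_of_not_isZero hA
      have hB0 := finrank_pos_of_not_isZero hB
      obtain ⟨hSA, hSB⟩ := annihilates_prod.1 (hAB.annihilates hS.1)
      obtain ⟨SA, hSA'⟩ := Preprojective.exists_isShortest hQ ⟨S, hSA⟩
      obtain ⟨SB, hSB'⟩ := Preprojective.exists_isShortest hQ ⟨S, hSB⟩
      -- The maximum of the two shortest sequences annihilates `M`, and `S` annihilates both
      -- summands. So the multiplicity of `x` in `S` is the larger of the two, and the summand
      -- attaining it is followed.
      obtain ⟨R, hR, hRc⟩ := ((admissibleVec_count hSA'.admissible).max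
        (admissibleVec_count hSB'.admissible)).exists_admissible hQ
      have hRM : Annihilates R M := hAB.symm.annihilates (annihilates_prod.2
        ⟨hSA'.1.mono hQ hR fun v => by rw [hRc]; omega,
          hSB'.1.mono hQ hR fun v => by rw [hRc]; omega⟩)
      have h1 := hS.le hQ hRM x
      have h2 := hSA'.le hQ hSA x
      have h3 := hSB'.le hQ hSB x
      rw [hRc] at h1
      rcases le_total (SA.count x) (SB.count x) with h | h
      · obtain ⟨Y, T, hY, hYB, hT, hTc⟩ := ih (by omega) hB hSB' x
        exact ⟨Y, T, hY, hYB.of_isomorphic_prod (hAB.trans (isomorphic_prod_comm A B)), hT,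
          by omega⟩
      · obtain ⟨Y, T, hY, hYA, hT, hTc⟩ := ih (by omega) hA hSA' x
        exact ⟨Y, T, hY, hYA.of_isomorphic_prod hAB, hT, by omega⟩

theorem IsShortest.count_eq_zero (hQ : Q.Acyclic) {S : List V} (hS : IsShortest S M)
    (hM : M.IsZero) (v : V) : S.count v = 0 :=
  Nat.le_zero.1 (hS.le hQ (annihilates_nil.2 hM) v)

end Rep
end FinQuiver

/-! ### Proof of the theorem -/

theorem theorem3p4 {V : Type u} {E : Type v} {k : Type w}
    [Fintype V] [DecidableEq V] [Nontrivial V] [Fintype E] [Field k]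
    (Q : FinQuiver V E) (hconn : Q.Connected) (hacyc : Q.Acyclic)
    (M : FinQuiver.Rep k Q) (hM : M.Preprojective) :
    -- existence and uniqueness of the shortest sequence
    (∃ S : List V, FinQuiver.Rep.IsShortest S M ∧
      ∀ T : List V, FinQuiver.Rep.IsShortest T M → Q.SeqEquiv T S) ∧
    -- the shortest sequence of a direct sum of indecomposables
    (∀ (t : ℕ) (N : Fin t → FinQuiver.Rep k Q) (m : Fin t → ℕ),
      (∀ i, (N i).Indecomposable) →
      (∀ i j, i ≠ j → ¬ (N i).Isomorphic (N j)) →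
      (∀ i, 0 < m i) →
      M.Isomorphic (FinQuiver.Rep.directSum fun i => (N i).power (m i)) →
      (∀ i, (N i).Preprojective) ∧
      ∀ (S : List V) (T : Fin t → List V), FinQuiver.Rep.IsShortest S M →
        (∀ i, FinQuiver.Rep.IsShortest (T i) (N i)) → Q.IsListJoin (List.ofFn T) S) ∧
    -- comparison with another preprojective module
    (∀ L : FinQuiver.Rep k Q, L.Preprojective →
      ∀ SL SM : List V, FinQuiver.Rep.IsShortest SL L → FinQuiver.Rep.IsShortest SM M →
        (Q.SeqLE SL SM ↔
          ∀ X : FinQuiver.Rep k Q, X.Indecomposable → X.IsSummand L →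
            ∃ Y : FinQuiver.Rep k Q, Y.Indecomposable ∧ Y.IsSummand M ∧
              ∃ SX SY : List V, FinQuiver.Rep.IsShortest SX X ∧
                FinQuiver.Rep.IsShortest SY Y ∧ Q.SeqLE SX SY)) := by
  open FinQuiver FinQuiver.Rep in
  refine ⟨?_, ?_, ?_⟩
  · obtain ⟨S, hS⟩ := hM.exists_isShortest hacyc
    exact ⟨S, hS, fun T hT =>
      seqEquiv_of_count_eq hT.admissible hS.admissible (hT.count_eq hacyc hS)⟩
  · intro t N m _ _ hm hiso
    have hann : ∀ S, Q.Admissible S → (Annihilates S M ↔ ∀ i, Annihilates S (N i)) := by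
      intro S hS
      rw [← forall_congr' fun i => annihilates_power (M := N i) hS (hm i),
        ← annihilates_directSum hS]
      exact ⟨hiso.annihilates, hiso.symm.annihilates⟩
    refine ⟨fun i => ?_, fun S T hS hT => ?_⟩
    · obtain ⟨S, hS⟩ := hM
      exact ⟨S, (hann S hS.1).1 hS i⟩
    · refine isListJoin_of_isLeast hacyc hS.admissible ?_ ?_ ?_
      · rw [List.forall_mem_ofFn_iff]
        exact fun i => (hT i).admissible
      · rw [List.forall_mem_ofFn_iff]
        exact fun i => (hT i).le hacyc ((hann S hS.admissible).1 hS.1 i)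
      · intro R hR hle
        rw [List.forall_mem_ofFn_iff] at hle
        exact hS.le hacyc ((hann R hR).2 fun i => (hT i).1.mono hacyc hR (hle i))
  · intro L _ SL SM hSL hSM
    rw [seqLE_iff hacyc hSL.admissible hSM.admissible]
    constructor
    · intro hle X hX hXL
      obtain ⟨SX, hSX⟩ := Preprojective.exists_isShortest hacyc ⟨SL, hXL.annihilates hSL.1⟩
      -- At the deciding vertex, `S_X ≤ S_L ≤ S_M`, and some `S_Y` attains the last value;
      -- join-primality extends the inequality to all vertices. Positivity at `x` ensures `M ≠ 0`,
      -- so that such a `Y` exists.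
      obtain ⟨x, hx0, hx⟩ := hX.exists_joinPrime hacyc hSX
      have h1 := hSX.le hacyc (hXL.annihilates hSL.1) x
      have h2 := hle x
      have hM0 : ¬ M.IsZero := fun h => by
        have := hSM.count_eq_zero hacyc h x
        omega
      obtain ⟨Y, SY, hY, hYM, hSY, hc⟩ := hSM.exists_summand hacyc _ le_rfl hM0 x
      exact ⟨Y, hY, hYM, SX, SY, hSX, hSY, (seqLE_iff hacyc hSX.admissible hSY.admissible).2
        (hx SY hSY.admissible (by omega))⟩
    · intro h v
      by_cases hL0 : L.IsZero
      · rw [hSL.count_eq_zero hacyc hL0]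
        exact Nat.zero_le _
      · obtain ⟨X, SX, hX, hXL, hSX, hc⟩ := hSL.exists_summand hacyc _ le_rfl hL0 v
        obtain ⟨Y, -, hYM, SX', SY, hSX', hSY, hle⟩ := h X hX hXL
        rw [← hc, hSX.count_eq hacyc hSX' v]
        exact ((seqLE_iff hacyc hSX'.admissible hSY.admissible).1 hle v).trans
          (hSY.le hacyc (hYM.annihilates hSM.1) v)
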